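/- Let $\mathcal H_+$ and $\mathcal H_-$ be complex Hilbert spaces, let $A$ and $D$ be (possibly unbounded) self-adjoint operators in $\mathcal H_+$ and $\mathcal H_-$, respectively, let $B:\mathcal H_-\to\mathcal H_+$ be a bounded linear operator, and let $$S=\begin{pmatrix}A&B\\-B^*&D\end{pmatrix},\qquad \operatorname{dom}S=\operatorname{dom}A\oplus\operatorname{dom}D,$$ in the orthogonal sum $\mathcal H_+\oplus\mathcal H_-$. For a linear operator $T$, let $\rho(T)$ denote the set of $z\in\mathbb C$ for which $T-z$ has a bounded, everywhere defined inverse, and let $\sigma(T)=\mathbb C\setminus\rho(T)$. Let $\sigma_B(A)\subseteq\mathbb R$ denote the support of the operator-valued measure $B^*E_A(\cdot)B$, where $E_A$ is the spectral measure of $A$; that is, $t\in\sigma_B(A)$ if and only if $B^*E_A(U)B\neq0$ for every open $U\subseteq\mathbb R$ with $t\in U$. Let $\mathcal B_r(a)=\{z\in\mathbb C:|z-a|\le r\}$. Assume that $0\in\rho(A)$ and put $c=\|A^{-1}B\|$. Then $$\sigma(S)\setminus\mathbb R\subseteq\bigcup_{a\in\sigma_B(A)}\mathcal B_{|a|c}(a).\tag{1}$$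 Assume, in addition, that $c<1$. Then the following hold. (i) The right-hand side of (1) is contained in $$\Bigl\{z\in\mathbb C:\ |\operatorname{Im}z|\le\frac{c}{\sqrt{1-c^2}}\,|\operatorname{Re}z|\Bigr\},$$ and this set is the closed double sector around the real axis with apex $0$ and half opening angle $\arcsin c$, i.e. it consists of $0$ and of all $z\ne0$ with $|\arg z|\le\arcsin c$ or $|\arg(-z)|\le\arcsin c$, where $\arg$ is the principal argument in $(-\pi,\pi]$. (ii) If $\sigma(A)\cap(0,\infty)\neq\varnothing$, then this set has a minimum, and every $z\in\sigma(S)\setminus\mathbb R$ with $\operatorname{Re}z>0$ satisfies $\operatorname{Re}z\ge(1-c)\min\bigl(\sigma(A)\cap(0,\infty)\bigr)$. If $\sigma(A)\cap(0,\infty)=\varnothing$, then there is no $z\in\sigma(S)\setminus\mathbb R$ with $\operatorname{Re}z>0$. (iii) If $\sigma(A)\cap(-\infty,0)\neq\varnothing$, then this set has a maximum, and every $z\in\sigma(S)\setminus\mathbb R$ with $\operatorname{Re}z<0$ satisfies $\operatorname{Re}z\le(1-c)\max\bigl(\sigma(A)\cap(-\infty,0)\bigr)$. If $\sigma(A)\cap(-\infty,0)=\varnothing$,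 then there is no $z\in\sigma(S)\setminus\mathbb R$ with $\operatorname{Re}z<0$. -/

import Mathlib

open MeasureTheory
open scoped InnerProductSpace InnerProduct ENNReal

noncomputable section

namespace SpecEncl

section Resolvent

variable {H : Type*} [NormedAddCommGroup H] [NormedSpace ℂ H]

/-- The bounded everywhere defined operator `R` is a two-sided inverse of `T - z : dom T → H`,
where `T` is a (possibly unbounded) linear operator in `H`. -/
def IsBoundedInverseAt (T : H →ₗ.[ℂ] H) (z : ℂ) (R : H →L[ℂ] H) : Prop :=
  (∀ x : T.domain, R (T x - z • (x : H)) = (x : H)) ∧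
    ∀ y : H, ∃ x : T.domain, (x : H) = R y ∧ T x - z • (x : H) = y

/-- A bounded inverse of `T - z` is unique. -/
theorem IsBoundedInverseAt.unique {T : H →ₗ.[ℂ] H} {z : ℂ} {R R' : H →L[ℂ] H}
    (h : IsBoundedInverseAt T z R) (h' : IsBoundedInverseAt T z R') : R = R' := by
  ext y
  obtain ⟨x, hx, hxy⟩ := h'.2 y
  rw [← hx, ← hxy, h.1 x]

/-- The resolvent set `ρ(T)`. -/
def resolventSet (T : H →ₗ.[ℂ] H) : Set ℂ := {z | ∃ R : H →L[ℂ] H, IsBoundedInverseAt T z R}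

/-- The spectrum `σ(T)`. -/
def spectrum (T : H →ₗ.[ℂ] H) : Set ℂ := (resolventSet T)ᶜ

/-- The real points of the spectrum `σ(T)`, as a set of real numbers. -/
def realSpectrum (T : H →ₗ.[ℂ] H) : Set ℝ := {t | (t : ℂ) ∈ spectrum T}

open Classical in
/-- `(T - z)⁻¹` as a bounded operator on `H`, for `z ∈ ρ(T)` (and `0` for other `z`). -/
def resolventOp (T : H →ₗ.[ℂ] H) (z : ℂ) : H →L[ℂ] H :=
  if h : ∃ R : H →L[ℂ] H, IsBoundedInverseAt T z R then h.choose else 0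

theorem isBoundedInverseAt_resolventOp {T : H →ₗ.[ℂ] H} {z : ℂ} (hz : z ∈ resolventSet T) :
    IsBoundedInverseAt T z (resolventOp T z) := by
  have h : ∃ R : H →L[ℂ] H, IsBoundedInverseAt T z R := hz
  rw [resolventOp, dif_pos h]
  exact h.choose_spec

end Resolvent

section SpectralMeasure

variable {H : Type*} [NormedAddCommGroup H] [InnerProductSpace ℂ H] [CompleteSpace H]

/-- A projection-valued measure on the Borel sets of `ℝ`: its values are orthogonal projections
in `H`, the whole line has value `1`, and it is countably additive in the strong operator
topology.  (Values at non-measurable sets carry no meaning.) -/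
structure ProjectionMeasure (H : Type*) [NormedAddCommGroup H] [InnerProductSpace ℂ H]
    [CompleteSpace H] where
  /-- the projection attached to a set -/
  proj : Set ℝ → (H →L[ℂ] H)
  isStarProjection : ∀ s, MeasurableSet s → IsStarProjection (proj s)
  proj_empty : proj ∅ = 0
  proj_univ : proj Set.univ = 1
  hasSum_proj : ∀ s : ℕ → Set ℝ, (∀ i, MeasurableSet (s i)) →
    Pairwise (Function.onFun Disjoint s) →
      ∀ x : H, HasSum (fun i => proj (s i) x) (proj (⋃ i, s i) x)

namespace ProjectionMeasure

theorem inner_proj_self (E : ProjectionMeasure H) {s : Set ℝ} (hs : MeasurableSet s) (x : H) :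
    ⟪x, E.proj s x⟫_ℂ = ((‖E.proj s x‖ ^ 2 : ℝ) : ℂ) := by
  have hp := E.isStarProjection s hs
  have h1 : E.proj s (E.proj s x) = E.proj s x :=
    congrArg (fun P : H →L[ℂ] H => P x) hp.isIdempotentElem.eq
  have h2 : ContinuousLinearMap.adjoint (E.proj s) = E.proj s := hp.isSelfAdjoint
  calc ⟪x, E.proj s x⟫_ℂ = ⟪x, E.proj s (E.proj s x)⟫_ℂ := by rw [h1]
    _ = ⟪ContinuousLinearMap.adjoint (E.proj s) x, E.proj s x⟫_ℂ :=
        (ContinuousLinearMap.adjoint_inner_left _ _ _).symm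
    _ = ⟪E.proj s x, E.proj s x⟫_ℂ := by rw [h2]
    _ = ((‖E.proj s x‖ ^ 2 : ℝ) : ℂ) := by
        rw [inner_self_eq_norm_sq_to_K]; push_cast; rfl

theorem hasSum_norm_sq (E : ProjectionMeasure H) (x : H) {s : ℕ → Set ℝ}
    (hs : ∀ i, MeasurableSet (s i)) (hd : Pairwise (Function.onFun Disjoint s)) :
    HasSum (fun i => ‖E.proj (s i) x‖ ^ 2) (‖E.proj (⋃ i, s i) x‖ ^ 2) := by
  have h := (E.hasSum_proj s hs hd x).mapL (innerSL ℂ x)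
  simp only [innerSL_apply_apply, E.inner_proj_self (hs _),
    E.inner_proj_self (MeasurableSet.iUnion hs)] at h
  exact Complex.hasSum_ofReal.mp h

/-- The scalar measure `Δ ↦ ⟪E(Δ) x, x⟫ = ‖E(Δ) x‖²` on the Borel sets of `ℝ`. -/
def scalarMeasure (E : ProjectionMeasure H) (x : H) : Measure ℝ :=
  Measure.ofMeasurable (fun s _ => ENNReal.ofReal (‖E.proj s x‖ ^ 2))
    (by simp [E.proj_empty])
    (by
      intro s hs hd
      have h := E.hasSum_norm_sq x hs hd
      rw [← h.tsum_eq, ENNReal.ofReal_tsum_of_nonneg (fun _ => by positivity) h.summable])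

theorem scalarMeasure_apply (E : ProjectionMeasure H) (x : H) {s : Set ℝ}
    (hs : MeasurableSet s) :
    E.scalarMeasure x s = ENNReal.ofReal (‖E.proj s x‖ ^ 2) :=
  Measure.ofMeasurable_apply s hs

/-- `E` is the spectral measure of `T`, that is, `T = ∫ t dE(t)`: the domain of `T` consists of
the `x` with `∫ t² d⟪E(t) x, x⟫ < ∞`, and `⟪T x, x⟫ = ∫ t d⟪E(t) x, x⟫` for these `x` (by
polarization this determines `T`).  By the spectral theorem every self-adjoint operator has one and
only one spectral measure. -/
def IsSpectralMeasureOf (E : ProjectionMeasure H) (T : H →ₗ.[ℂ] H) : Prop :=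
  (∀ x : H, x ∈ T.domain ↔ Integrable (fun t : ℝ => t ^ 2) (E.scalarMeasure x)) ∧
    ∀ x : T.domain, ⟪(x : H), T x⟫_ℂ = ((∫ t : ℝ, t ∂(E.scalarMeasure (x : H)) : ℝ) : ℂ)

/-- The support of the positive operator-valued measure `V* E(·) V`: the points `t` none of whose
open neighbourhoods is a null set of it. -/
def compressedSupport {K : Type*} [NormedAddCommGroup K] [InnerProductSpace ℂ K]
    [CompleteSpace K] (E : ProjectionMeasure H) (V : K →L[ℂ] H) : Set ℝ :=
  {t | ∀ U : Set ℝ, IsOpen U → t ∈ U →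
    (ContinuousLinearMap.adjoint V) ∘L (E.proj U) ∘L V ≠ 0}

end ProjectionMeasure

/-- `σ_V(T)`, for a self-adjoint operator `T` in `H` and a bounded operator `V : K → H`: the support
of `V* E_T(·) V`, where `E_T` is the spectral measure of `T`. -/
def spectrumAlong {K : Type*} [NormedAddCommGroup K] [InnerProductSpace ℂ K] [CompleteSpace K]
    (V : K →L[ℂ] H) (T : H →ₗ.[ℂ] H) : Set ℝ :=
  {t | ∃ E : ProjectionMeasure H, E.IsSpectralMeasureOf T ∧ t ∈ E.compressedSupport V}

end SpectralMeasure

section BlockOperator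

variable {H₁ H₂ : Type*} [NormedAddCommGroup H₁] [InnerProductSpace ℂ H₁]
  [NormedAddCommGroup H₂] [InnerProductSpace ℂ H₂]

/-- The block operator matrix with rows `(A, B)` and `(C, D)` in the orthogonal sum `H₁ ⊕ H₂`, with
domain `dom A ⊕ dom D`. -/
def blockOperator (A : H₁ →ₗ.[ℂ] H₁) (B : H₂ →L[ℂ] H₁) (C : H₁ →L[ℂ] H₂) (D : H₂ →ₗ.[ℂ] H₂) :
    WithLp 2 (H₁ × H₂) →ₗ.[ℂ] WithLp 2 (H₁ × H₂) where
  domain :=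
    { carrier := {x | x.fst ∈ A.domain ∧ x.snd ∈ D.domain}
      add_mem' := fun ha hb => ⟨A.domain.add_mem ha.1 hb.1, D.domain.add_mem ha.2 hb.2⟩
      zero_mem' := ⟨A.domain.zero_mem, D.domain.zero_mem⟩
      smul_mem' := fun c _ hx => ⟨A.domain.smul_mem c hx.1, D.domain.smul_mem c hx.2⟩ }
  toFun :=
    { toFun := fun x => WithLp.toLp 2
        (A ⟨x.1.fst, x.2.1⟩ + B x.1.snd, C x.1.fst + D ⟨x.1.snd, x.2.2⟩)
      map_add' := by
        intro x y
        have hA : A ⟨(x + y).1.fst, (x + y).2.1⟩ = A ⟨x.1.fst, x.2.1⟩ + A ⟨y.1.fst, y.2.1⟩ :=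
          A.map_add ⟨x.1.fst, x.2.1⟩ ⟨y.1.fst, y.2.1⟩
        have hD : D ⟨(x + y).1.snd, (x + y).2.2⟩ = D ⟨x.1.snd, x.2.2⟩ + D ⟨y.1.snd, y.2.2⟩ :=
          D.map_add ⟨x.1.snd, x.2.2⟩ ⟨y.1.snd, y.2.2⟩
        rw [hA, hD, ← WithLp.toLp_add]
        congr 1
        ext
        · simp; abel
        · simp; abel
      map_smul' := by
        intro c x
        have hA : A ⟨(c • x).1.fst, (c • x).2.1⟩ = c • A ⟨x.1.fst, x.2.1⟩ :=
          A.map_smul c ⟨x.1.fst, x.2.1⟩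
        have hD : D ⟨(c • x).1.snd, (c • x).2.2⟩ = c • D ⟨x.1.snd, x.2.2⟩ :=
          D.map_smul c ⟨x.1.snd, x.2.2⟩
        rw [hA, hD, RingHom.id_apply, ← WithLp.toLp_smul]
        congr 1
        ext
        · simp
        · simp }

end BlockOperator

/-- The points of `ℂ` that are not real. -/
def nonreal : Set ℂ := {z | z.im ≠ 0}

/-- The closed double sector around the real axis with apex `0` and half opening angle `φ`. -/
def doubleSector (φ : ℝ) : Set ℂ := {z | |z.arg| ≤ φ ∨ |(-z).arg| ≤ φ}

end SpecEncl

end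

noncomputable section

namespace SpecEncl

/-! ### Self-adjoint operators and their coercive bounded perturbations -/

section SelfAdjoint

variable {H : Type*} [NormedAddCommGroup H] [InnerProductSpace ℂ H] [CompleteSpace H]

/-! Fix a nonreal `z` and let `R = (A - z)⁻¹`. Eliminating the first component reduces the
invertibility of `S - z` to that of the Schur complement `D - z + B* R B`. Because `D` is
self-adjoint and `Im ⟪y, R y⟫ = Im z ‖R y‖²`, the quadratic form of the Schur complement at `x` has
imaginary part `-Im z (‖x‖² - ‖R B x‖²)`. So `z ∈ ρ(S)` as soon as `‖R B‖ < 1`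
(`exists_inverse_add_of_coercive_im`, `mem_resolventSet_blockOperator`).

With `μ` the scalar spectral measure of `A` at `B x`, which is carried by `σ_B(A)`, one has `‖R B
x‖² = ∫ |t - z|⁻² dμ` and `∫ t⁻² dμ = ‖A⁻¹ B x‖² ≤ c² ‖x‖²`. If `z` lies outside all the discs, then
`|t - z| > c |t|` on `σ_B(A)`, and comparing the integrals gives `‖R B x‖ ≤ ‖x‖`. The required
strict uniform bound is supplied by `exists_uniform_resolvent_bound`, which also uses `μ(ℝ) = ‖B
x‖²`.

The spectral measure is built from the bounded self-adjoint operator `T = A⁻¹`: continuous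
functional calculus, Riesz–Markov measures on the spectrum of `T`, projections for all Borel sets,
and push-forward along `s ↦ s⁻¹`. All integrals are taken on the spectrum of `T`, where `|t - z|⁻²`
becomes `s² / |1 - z s|²`. Since `spectrumAlong` asks only for some spectral measure, existence
suffices and uniqueness is not needed. The support of the constructed measure also lies in `σ(A)`,
so every nonreal spectral point of `S` lies in a disc whose centre belongs to both `σ(A)` and
`σ_B(A)`. Claims (i)–(iii) are then plane geometry of these discs, together with the closedness of
`σ(A)` and `0 ∉ σ(A)`. -/

theorem inner_map_eq_of_isSelfAdjoint {T : H →ₗ.[ℂ] H} (hT : IsSelfAdjoint T)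
    (x y : T.domain) : ⟪T x, (y : H)⟫_ℂ = ⟪(x : H), T y⟫_ℂ := by
  have h := LinearPMap.adjoint_isFormalAdjoint (T := T) hT.dense_domain
  rw [LinearPMap.isSelfAdjoint_def.mp hT] at h
  exact h x y

theorem inner_self_map_im_of_isSelfAdjoint {T : H →ₗ.[ℂ] H} (hT : IsSelfAdjoint T)
    (x : T.domain) : (⟪(x : H), T x⟫_ℂ).im = 0 := by
  have h := inner_map_eq_of_isSelfAdjoint hT x x
  rw [← inner_conj_symm] at h
  exact Complex.conj_eq_iff_im.mp h

theorem exists_domain_of_forall_inner_eq {T : H →ₗ.[ℂ] H} (hT : IsSelfAdjoint T) {v w : H}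
    (h : ∀ x : T.domain, ⟪w, (x : H)⟫_ℂ = ⟪v, T x⟫_ℂ) :
    ∃ u : T.domain, (u : H) = v ∧ T u = w := by
  have hv : v ∈ (LinearPMap.adjoint T).domain := LinearPMap.mem_adjoint_domain_of_exists v ⟨w, h⟩
  have hw := LinearPMap.adjoint_apply_eq hT.dense_domain ⟨v, hv⟩ h
  rw [LinearPMap.isSelfAdjoint_def.mp hT] at hv
  refine ⟨⟨v, hv⟩, rfl, ?_⟩
  have hle : T ≤ LinearPMap.adjoint T := (LinearPMap.isSelfAdjoint_def.mp hT).ge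
  rw [← hw]
  exact hle.2 rfl

/-- A bounded perturbation of a self-adjoint operator whose numerical range stays away from the
real axis has a bounded everywhere defined inverse. -/
theorem exists_inverse_add_of_coercive_im {T : H →ₗ.[ℂ] H} (hT : IsSelfAdjoint T) (K : H →L[ℂ] H)
    {ε : ℝ} (hε : 0 < ε) (hK : ∀ x : H, ε * ‖x‖ ^ 2 ≤ |(⟪x, K x⟫_ℂ).im|) :
    ∃ R : H →L[ℂ] H, (∀ x : T.domain, R (T x + K x) = x) ∧
      ∀ y : H, ∃ x : T.domain, (x : H) = R y ∧ T x + K x = y := by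
  have hlow : ∀ x : T.domain, ε * ‖(x : H)‖ ≤ ‖T x + K x‖ := by
    intro x
    have h1 : ε * ‖(x : H)‖ ^ 2 ≤ ‖(x : H)‖ * ‖T x + K x‖ := by
      calc ε * ‖(x : H)‖ ^ 2 ≤ |(⟪(x : H), K x⟫_ℂ).im| := hK x
        _ = |(⟪(x : H), T x + K x⟫_ℂ).im| := by
          rw [inner_add_right, Complex.add_im, inner_self_map_im_of_isSelfAdjoint hT, zero_add]
        _ ≤ ‖⟪(x : H), T x + K x⟫_ℂ‖ := Complex.abs_im_le_norm _
        _ ≤ _ := norm_inner_le_norm _ _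
    rcases (norm_nonneg (x : H)).eq_or_lt with h | h
    · rw [← h, mul_zero]; exact norm_nonneg _
    · exact le_of_mul_le_mul_left (by linarith [h1, sq ‖(x : H)‖]) h
  have hcl : _root_.IsClosed (T.graph : Set (H × H)) := hT.isClosed
  have : CompleteSpace T.graph := hcl.completeSpace_coe
  -- On the graph, which is complete because `T` is closed, `T + K` becomes a bounded operator. A
  -- lower bound for it gives injectivity and closed range.
  let Φ : T.graph →L[ℂ] H :=
    (ContinuousLinearMap.snd ℂ H H + K ∘L ContinuousLinearMap.fst ℂ H H) ∘L T.graph.subtypeL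
  have hΦ : ∀ p : T.graph, Φ p = p.1.2 + K p.1.1 := fun p => rfl
  have hmem : ∀ x : T.domain, ((x : H), T x) ∈ T.graph := fun x => T.mem_graph x
  have hlowΦ : ∀ p : T.graph, ε * ‖p.1.1‖ ≤ ‖Φ p‖ := by
    intro p
    obtain ⟨x, hx1, hx2⟩ := (LinearPMap.mem_graph_iff T).mp p.2
    rw [hΦ, ← hx1, ← hx2]
    exact hlow x
  have hanti : AntilipschitzWith (Real.toNNReal (ε⁻¹ + (1 + ‖K‖ * ε⁻¹))) Φ := by
    refine AddMonoidHomClass.antilipschitz_of_bound Φ fun p => ?_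
    rw [Real.coe_toNNReal _ (by positivity)]
    have h1 : ‖p.1.1‖ ≤ ε⁻¹ * ‖Φ p‖ := by
      rw [inv_mul_eq_div, le_div_iff₀ hε, mul_comm]; exact hlowΦ p
    have h2 : ‖p.1.2‖ ≤ ‖Φ p‖ + ‖K‖ * (ε⁻¹ * ‖Φ p‖) := by
      calc ‖p.1.2‖ = ‖Φ p - K p.1.1‖ := by rw [hΦ]; simp
        _ ≤ ‖Φ p‖ + ‖K p.1.1‖ := norm_sub_le _ _
        _ ≤ ‖Φ p‖ + ‖K‖ * (ε⁻¹ * ‖Φ p‖) := by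
          gcongr
          exact (K.le_opNorm _).trans (by gcongr)
    have h3 : ‖p‖ ≤ ‖p.1.1‖ + ‖p.1.2‖ := by
      change max ‖p.1.1‖ ‖p.1.2‖ ≤ _
      exact max_le (by linarith [norm_nonneg p.1.2]) (by linarith [norm_nonneg p.1.1])
    calc ‖p‖ ≤ ε⁻¹ * ‖Φ p‖ + (‖Φ p‖ + ‖K‖ * (ε⁻¹ * ‖Φ p‖)) := by linarith
      _ = _ := by ring
  have hclosed : _root_.IsClosed (Set.range Φ) :=
    hanti.isClosed_range Φ.uniformContinuous
  have hsurj : Φ.range = ⊤ := by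
    have hc : _root_.IsClosed ((Φ.range : Submodule ℂ H) : Set H) := by
      convert hclosed using 1; exact LinearMap.coe_range _
    have : CompleteSpace (Φ.range : Submodule ℂ H) := hc.completeSpace_coe
    rw [← Submodule.orthogonal_eq_bot_iff, Submodule.eq_bot_iff]
    intro v hv
    have h0 : ∀ x : T.domain, ⟪v, T x + K x⟫_ℂ = 0 := fun x =>
      (Submodule.mem_orthogonal' _ _).mp hv _ ⟨⟨_, hmem x⟩, rfl⟩
    -- A vector `v` orthogonal to the range lies in the domain of `T* = T` and satisfies `T v = -K*
    -- v`. As `⟪v, T v⟫` is real, so is `⟪v, K v⟫`, and coercivity forces `v = 0`.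
    obtain ⟨u, hu, hTu⟩ := exists_domain_of_forall_inner_eq hT (v := v)
      (w := -(ContinuousLinearMap.adjoint K v)) (fun x => by
        rw [inner_neg_left, ContinuousLinearMap.adjoint_inner_left]
        have := h0 x
        rw [inner_add_right] at this
        linear_combination -this)
    have h1 := inner_self_map_im_of_isSelfAdjoint hT u
    rw [hTu, hu, inner_neg_right, ContinuousLinearMap.adjoint_inner_right, ← inner_conj_symm] at h1
    simp only [Complex.neg_im, Complex.conj_im, neg_neg] at h1
    have h2 := hK v
    rw [h1, abs_zero] at h2
    have h3 : ‖v‖ ^ 2 ≤ 0 := by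
      by_contra hcon
      push Not at hcon
      nlinarith
    exact norm_eq_zero.mp (pow_eq_zero_iff two_ne_zero |>.mp (le_antisymm h3 (by positivity)))
  have hker : Φ.ker = ⊥ := LinearMap.ker_eq_bot.mpr hanti.injective
  let e := ContinuousLinearEquiv.ofBijective Φ hker hsurj
  have he : ∀ p, e p = Φ p := fun p => rfl
  refine ⟨ContinuousLinearMap.fst ℂ H H ∘L T.graph.subtypeL ∘L
    (e.symm : H →L[ℂ] T.graph), fun x => ?_, fun y => ?_⟩
  · have : e.symm (T x + K x) = ⟨_, hmem x⟩ := by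
      rw [ContinuousLinearEquiv.symm_apply_eq]; rfl
    simp [this]
  · obtain ⟨x, hx1, hx2⟩ := (LinearPMap.mem_graph_iff T).mp (e.symm y).2
    refine ⟨x, hx1, ?_⟩
    rw [hx1, hx2, ← hΦ, ← he, e.apply_symm_apply]

theorem mem_resolventSet_of_im_ne_zero {T : H →ₗ.[ℂ] H} (hT : IsSelfAdjoint T) {z : ℂ}
    (hz : z.im ≠ 0) : z ∈ resolventSet T := by
  obtain ⟨R, h1, h2⟩ := exists_inverse_add_of_coercive_im hT (-(z • ContinuousLinearMap.id ℂ H))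
    (abs_pos.mpr hz) (fun x => by
      simp only [neg_apply, smul_apply,
        ContinuousLinearMap.id_apply, inner_neg_right, inner_smul_right,
        inner_self_eq_norm_sq_to_K, Complex.coe_algebraMap]
      rw [← Complex.ofReal_pow, Complex.neg_im, Complex.im_mul_ofReal, abs_neg, abs_mul,
        abs_of_nonneg (sq_nonneg ‖x‖)])
  simp only [neg_apply, smul_apply,
        ContinuousLinearMap.id_apply, ← sub_eq_add_neg] at h1 h2
  exact ⟨R, h1, h2⟩

end SelfAdjoint

/-! ### Components of the block operator -/

section BlockOperator

variable {Hp Hm : Type*} [NormedAddCommGroup Hp] [InnerProductSpace ℂ Hp]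
  [NormedAddCommGroup Hm] [InnerProductSpace ℂ Hm]

theorem blockOperator_fst {A : Hp →ₗ.[ℂ] Hp} {B : Hm →L[ℂ] Hp} {C : Hp →L[ℂ] Hm}
    {D : Hm →ₗ.[ℂ] Hm} (x : (blockOperator A B C D).domain) (a : A.domain)
    (ha : (a : Hp) = x.1.fst) : (blockOperator A B C D x).fst = A a + B x.1.snd := by
  obtain rfl : a = ⟨x.1.fst, x.2.1⟩ := Subtype.ext ha
  rfl

theorem blockOperator_snd {A : Hp →ₗ.[ℂ] Hp} {B : Hm →L[ℂ] Hp} {C : Hp →L[ℂ] Hm}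
    {D : Hm →ₗ.[ℂ] Hm} (x : (blockOperator A B C D).domain) (b : D.domain)
    (hb : (b : Hm) = x.1.snd) : (blockOperator A B C D x).snd = C x.1.fst + D b := by
  obtain rfl : b = ⟨x.1.snd, x.2.2⟩ := Subtype.ext hb
  rfl

end BlockOperator

/-! ### Schur complement and the resolvent of the block operator -/

section Schur

variable {Hp Hm : Type*}
    [NormedAddCommGroup Hp] [InnerProductSpace ℂ Hp] [CompleteSpace Hp]
    [NormedAddCommGroup Hm] [InnerProductSpace ℂ Hm] [CompleteSpace Hm]

theorem inner_resolvent_im {A : Hp →ₗ.[ℂ] Hp} (hA : IsSelfAdjoint A) {z : ℂ} {R : Hp →L[ℂ] Hp}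
    (hR : IsBoundedInverseAt A z R) (y : Hp) :
    (⟪y, R y⟫_ℂ).im = z.im * ‖R y‖ ^ 2 := by
  obtain ⟨x, hx, hxy⟩ := hR.2 y
  have h1 := inner_self_map_im_of_isSelfAdjoint hA x
  rw [← hx]
  nth_rewrite 1 [← hxy]
  rw [inner_sub_left, inner_smul_left, inner_map_eq_of_isSelfAdjoint hA, Complex.sub_im, h1,
    inner_self_eq_norm_sq_to_K]
  simp only [Complex.coe_algebraMap]
  rw [← Complex.ofReal_pow, Complex.im_mul_ofReal, Complex.conj_im]
  ring

/-- The imaginary part of the form of `B* R B - z` is `Im z (‖R B x‖² - ‖x‖²)`, hence at least `|Im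
z| (1 - q) ‖x‖²` in modulus, and coercivity applies to this perturbation of `D`. -/
theorem exists_schur_inverse {A : Hp →ₗ.[ℂ] Hp} (hA : IsSelfAdjoint A)
    {D : Hm →ₗ.[ℂ] Hm} (hD : IsSelfAdjoint D) (B : Hm →L[ℂ] Hp) {z : ℂ} (hz : z.im ≠ 0)
    {R : Hp →L[ℂ] Hp} (hR : IsBoundedInverseAt A z R) {q : ℝ} (hq : q < 1)
    (hRB : ∀ x, ‖R (B x)‖ ^ 2 ≤ q * ‖x‖ ^ 2) :
    ∃ N : Hm →L[ℂ] Hm,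
      (∀ x : D.domain, N (D x - z • (x : Hm) + ContinuousLinearMap.adjoint B (R (B x))) = x) ∧
      ∀ y : Hm, ∃ x : D.domain, (x : Hm) = N y ∧
        D x - z • (x : Hm) + ContinuousLinearMap.adjoint B (R (B x)) = y := by
  obtain ⟨N, h1, h2⟩ := exists_inverse_add_of_coercive_im hD
    (ContinuousLinearMap.adjoint B ∘L R ∘L B - z • ContinuousLinearMap.id ℂ Hm)
    (ε := |z.im| * (1 - q)) (mul_pos (abs_pos.mpr hz) (by linarith)) (fun x => by
      simp only [sub_apply, smul_apply,
        ContinuousLinearMap.id_apply, ContinuousLinearMap.comp_apply, inner_sub_right,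
        inner_smul_right, inner_self_eq_norm_sq_to_K, Complex.coe_algebraMap,
        ContinuousLinearMap.adjoint_inner_right]
      rw [← Complex.ofReal_pow, Complex.sub_im, Complex.im_mul_ofReal,
        inner_resolvent_im hA hR, ← mul_sub, abs_mul, mul_assoc]
      gcongr
      rw [abs_sub_comm]
      refine le_trans ?_ (le_abs_self _)
      linarith [hRB x])
  have key : ∀ x : D.domain, D x - z • (x : Hm) + ContinuousLinearMap.adjoint B (R (B x)) =
      D x + (ContinuousLinearMap.adjoint B ∘L R ∘L B - z • ContinuousLinearMap.id ℂ Hm) x := by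
    intro x
    simp only [sub_apply, smul_apply,
        ContinuousLinearMap.id_apply, ContinuousLinearMap.comp_apply]
    abel
  simp only [key]
  exact ⟨N, h1, h2⟩

theorem mem_resolventSet_blockOperator {A : Hp →ₗ.[ℂ] Hp} (hA : IsSelfAdjoint A)
    {D : Hm →ₗ.[ℂ] Hm} (hD : IsSelfAdjoint D) (B : Hm →L[ℂ] Hp) {z : ℂ} (hz : z.im ≠ 0)
    {R : Hp →L[ℂ] Hp} (hR : IsBoundedInverseAt A z R) {q : ℝ} (hq : q < 1)
    (hRB : ∀ x, ‖R (B x)‖ ^ 2 ≤ q * ‖x‖ ^ 2) :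
    z ∈ resolventSet (blockOperator A B (-(ContinuousLinearMap.adjoint B)) D) := by
  obtain ⟨N, hN1, hN2⟩ := exists_schur_inverse hA hD B hz hR hq hRB
  let p1 : WithLp 2 (Hp × Hm) →L[ℂ] Hp := WithLp.fstL 2 ℂ Hp Hm
  let p2 : WithLp 2 (Hp × Hm) →L[ℂ] Hm := WithLp.sndL 2 ℂ Hp Hm
  -- Gaussian elimination: the first row gives `x = R (v₁ - B y)`, and inserting this in the second
  -- gives `(D - z + B* R B) y = v₂ + B* R v₁`.
  let Y : WithLp 2 (Hp × Hm) →L[ℂ] Hm := N ∘L (p2 + ContinuousLinearMap.adjoint B ∘L R ∘L p1)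
  let X : WithLp 2 (Hp × Hm) →L[ℂ] Hp := R ∘L (p1 - B ∘L Y)
  let W : WithLp 2 (Hp × Hm) →L[ℂ] WithLp 2 (Hp × Hm) :=
    ((WithLp.prodContinuousLinearEquiv 2 ℂ Hp Hm).symm : _ →L[ℂ] _) ∘L (X.prod Y)
  have hY : ∀ v, Y v = N (v.snd + ContinuousLinearMap.adjoint B (R v.fst)) := fun v => rfl
  have hX : ∀ v, X v = R (v.fst - B (Y v)) := fun v => rfl
  have hW1 : ∀ v, (W v).fst = X v := fun v => rfl
  have hW2 : ∀ v, (W v).snd = Y v := fun v => rfl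
  refine ⟨W, fun x => ?_, fun v => ?_⟩
  · obtain ⟨a, ha⟩ : ∃ a : A.domain, (a : Hp) = x.1.fst := ⟨⟨_, x.2.1⟩, rfl⟩
    obtain ⟨b, hb⟩ : ∃ b : D.domain, (b : Hm) = x.1.snd := ⟨⟨_, x.2.2⟩, rfl⟩
    set v := blockOperator A B (-(ContinuousLinearMap.adjoint B)) D x -
      z • (x : WithLp 2 (Hp × Hm)) with hv
    have hv1 : v.fst = A a - z • (a : Hp) + B b := by
      rw [hv, WithLp.sub_fst, WithLp.smul_fst, blockOperator_fst x a ha, ha, hb]; abel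
    have hv2 : v.snd = D b - z • (b : Hm) - ContinuousLinearMap.adjoint B a := by
      rw [hv, WithLp.sub_snd, WithLp.smul_snd, blockOperator_snd x b hb, neg_apply, ha, hb]; abel
    have hRA := hR.1 a
    have hy : Y v = b := by
      rw [hY, ← hN1 b, hv1, hv2, map_add R, hRA, map_add (ContinuousLinearMap.adjoint B)]
      congr 1
      abel
    have hx : X v = a := by
      rw [hX, hy, hv1, add_sub_cancel_right, hRA]
    refine WithLp.ofLp_injective 2 (Prod.ext ?_ ?_)
    · exact hx.trans ha
    · exact hy.trans hb
  · obtain ⟨a, ha, ha'⟩ := hR.2 (v.fst - B (Y v))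
    obtain ⟨b, hb, hb'⟩ := hN2 (v.snd + ContinuousLinearMap.adjoint B (R v.fst))
    rw [← hX] at ha
    rw [← hY] at hb
    have hmem : W v ∈ (blockOperator A B (-(ContinuousLinearMap.adjoint B)) D).domain := by
      refine ⟨?_, ?_⟩
      · rw [hW1, ← ha]; exact a.2
      · rw [hW2, ← hb]; exact b.2
    obtain ⟨w, hw⟩ : ∃ w : (blockOperator A B (-(ContinuousLinearMap.adjoint B)) D).domain,
      (w : WithLp 2 (Hp × Hm)) = W v := ⟨⟨W v, hmem⟩, rfl⟩
    refine ⟨w, hw, WithLp.ofLp_injective 2 (Prod.ext ?_ ?_)⟩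
    · change (blockOperator A B (-(ContinuousLinearMap.adjoint B)) D w - z • w.1).fst = v.fst
      rw [WithLp.sub_fst, WithLp.smul_fst, blockOperator_fst w a (by rw [ha, hw, hW1]), hw, hW1,
        hW2, ← ha, add_sub_right_comm, ha', sub_add_cancel]
    · change (blockOperator A B (-(ContinuousLinearMap.adjoint B)) D w - z • w.1).snd = v.snd
      rw [WithLp.sub_snd, WithLp.smul_snd, blockOperator_snd w b (by rw [hb, hw, hW2]), hw, hW1,
        hW2, neg_apply, hX, map_sub, map_sub, ← hb]
      rw [← add_left_inj (ContinuousLinearMap.adjoint B (R v.fst)), ← hb']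
      abel

end Schur

/-! ### Spectral projections of a representation of `C(X, ℝ)` -/

section FunctionalCalculus

open Filter Topology

theorem eq_of_forall_inner_self_eq {H : Type*} [NormedAddCommGroup H] [InnerProductSpace ℂ H]
    {P Q : H →L[ℂ] H}
    (h : ∀ x, ⟪x, P x⟫_ℂ = ⟪x, Q x⟫_ℂ) :
    P = Q := by
  have h' : (P : H →ₗ[ℂ] H) = (Q : H →ₗ[ℂ] H) := (ext_inner_map _ _).mp fun x => by
    have := congrArg (starRingEnd ℂ) (h x)
    rwa [inner_conj_symm, inner_conj_symm] at this
  exact ContinuousLinearMap.coe_injective h'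

variable {H : Type*} [NormedAddCommGroup H] [InnerProductSpace ℂ H] [CompleteSpace H]

theorem isSelfAdjoint_of_inner_self_eq_ofReal {P : H →L[ℂ] H} {r : H → ℝ}
    (h : ∀ x, ⟪x, P x⟫_ℂ = (r x : ℂ)) : IsSelfAdjoint P := by
  rw [ContinuousLinearMap.isSelfAdjoint_iff_isSymmetric,
    LinearMap.isSymmetric_iff_inner_map_self_real]
  intro x
  rw [inner_conj_symm, ContinuousLinearMap.coe_coe, ← inner_conj_symm (P x) x, h x,
    Complex.conj_ofReal]

theorem inner_apply_eq_of_isSelfAdjoint {P : H →L[ℂ] H} (hP : IsSelfAdjoint P) (x y : H) :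
    ⟪P x, y⟫_ℂ = ⟪x, P y⟫_ℂ := by
  have := ContinuousLinearMap.adjoint_inner_left P y x
  rwa [show ContinuousLinearMap.adjoint P = P from hP] at this

variable {X : Type*} [TopologicalSpace X] (π : C(X, ℝ) →⋆ₐ[ℝ] (H →L[ℂ] H))

theorem isSelfAdjoint_calculus (f : C(X, ℝ)) : IsSelfAdjoint (π f) := by
  change star (π f) = π f
  rw [← map_star]
  congr 1

theorem inner_calculus_left (f : C(X, ℝ)) (x y : H) : ⟪π f x, y⟫_ℂ = ⟪x, π f y⟫_ℂ :=
  inner_apply_eq_of_isSelfAdjoint (isSelfAdjoint_calculus π f) x y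

theorem calculus_mul_apply (f g : C(X, ℝ)) (x : H) : π (f * g) x = π f (π g x) := by
  rw [map_mul]; rfl

theorem calculus_one_apply (x : H) : π 1 x = x := by
  rw [map_one]; rfl

theorem inner_self_calculus (f : C(X, ℝ)) (x : H) :
    ⟪x, π f x⟫_ℂ = ((⟪x, π f x⟫_ℂ).re : ℂ) := by
  have h := inner_calculus_left π f x x
  rw [← inner_conj_symm] at h
  exact (Complex.conj_eq_iff_re.mp h).symm

theorem norm_sq_calculus (f : C(X, ℝ)) (x : H) :
    ‖π f x‖ ^ 2 = (⟪x, π (f * f) x⟫_ℂ).re := by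
  rw [calculus_mul_apply, ← inner_calculus_left, inner_self_eq_norm_sq_to_K]
  norm_cast

variable [CompactSpace X]

/-- The positive functional `f ↦ ⟪x, π f x⟫` attached to a representation of `C(X, ℝ)`. -/
def calculusFunctional (x : H) : CompactlySupportedContinuousMap X ℝ →ₚ[ℝ] ℝ :=
  PositiveLinearMap.mk₀
    { toFun := fun f => (⟪x, π f.toContinuousMap x⟫_ℂ).re
      map_add' := fun f g => by
        change (⟪x, π (f.toContinuousMap + g.toContinuousMap) x⟫_ℂ).re = _
        rw [map_add, add_apply, inner_add_right, Complex.add_re]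
      map_smul' := fun c f => by
        change (⟪x, π (c • f.toContinuousMap) x⟫_ℂ).re = _
        rw [map_smul, smul_apply, ← Complex.coe_smul, inner_smul_right, Complex.re_ofReal_mul]
        rfl }
    fun f hf => by
      -- Positivity: `f = √f · √f`, so the form of `π f` at `x` is `‖π (√f) x‖²`.
      have : f.toContinuousMap = (⟨fun s => √(f s), by fun_prop⟩ : C(X, ℝ)) *
          ⟨fun s => √(f s), by fun_prop⟩ := by
        ext s
        exact (Real.mul_self_sqrt (hf s)).symm
      change 0 ≤ (⟪x, π f.toContinuousMap x⟫_ℂ).re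
      rw [this, ← norm_sq_calculus]
      positivity

variable [T2Space X] [MeasurableSpace X] [BorelSpace X]

/-- The measure representing `f ↦ ⟪x, π f x⟫`. -/
def calculusMeasure (x : H) : Measure X := RealRMK.rieszMeasure (calculusFunctional π x)

instance (x : H) : IsFiniteMeasure (calculusMeasure π x) := by
  unfold calculusMeasure; infer_instance

theorem integral_calculusMeasure (f : C(X, ℝ)) (x : H) :
    ∫ s, f s ∂(calculusMeasure π x) = (⟪x, π f x⟫_ℂ).re :=
  RealRMK.integral_rieszMeasure (calculusFunctional π x)
    (CompactlySupportedContinuousMap.continuousMapEquiv f)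

theorem inner_self_calculus_eq_integral (f : C(X, ℝ)) (x : H) :
    ⟪x, π f x⟫_ℂ = ((∫ s, f s ∂(calculusMeasure π x) : ℝ) : ℂ) := by
  rw [integral_calculusMeasure, ← inner_self_calculus]

theorem norm_sq_calculus_eq_integral (f : C(X, ℝ)) (x : H) :
    ‖π f x‖ ^ 2 = ∫ s, f s ^ 2 ∂(calculusMeasure π x) := by
  rw [norm_sq_calculus, ← integral_calculusMeasure]
  simp [sq]

theorem integrable_calculusMeasure (f : C(X, ℝ)) (x : H) : Integrable f (calculusMeasure π x) :=
  f.continuous.integrable_of_hasCompactSupport (HasCompactSupport.of_compactSpace f)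

/-- Dominated convergence for the continuous functional calculus. -/
theorem exists_tendsto_calculus {f : ℕ → C(X, ℝ)} {F G : X → ℝ} {x : H}
    (hG : Integrable (fun s => G s ^ 2) (calculusMeasure π x))
    (hfG : ∀ n s, |f n s| ≤ G s) (hfF : ∀ s, Tendsto (fun n => f n s) atTop (𝓝 (F s))) :
    ∃ v, Tendsto (fun n => π (f n) x) atTop (𝓝 v) := by
  apply cauchySeq_tendsto_of_complete
  rw [cauchySeq_iff_tendsto_dist_atTop_0]
  -- The map `f ↦ π f x` is an isometry for the `L²` norm of the measure at `x`, so dominated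
  -- convergence makes the sequence Cauchy.
  have h1 : ∀ n : ℕ × ℕ, dist (π (f n.1) x) (π (f n.2) x) =
      √(∫ s, (f n.1 s - f n.2 s) ^ 2 ∂(calculusMeasure π x)) := by
    intro n
    have := norm_sq_calculus_eq_integral π (f n.1 - f n.2) x
    rw [map_sub, sub_apply] at this
    rw [dist_eq_norm, ← Real.sqrt_sq (norm_nonneg _), this]
    rfl
  simp_rw [h1]
  rw [← Real.sqrt_zero]
  refine (Real.continuous_sqrt.tendsto 0).comp ?_
  have h2 : ∫ _, (0 : ℝ) ∂(calculusMeasure π x) = 0 := by simp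
  rw [← h2]
  refine tendsto_integral_filter_of_dominated_convergence (fun s => 4 * G s ^ 2)
    (Eventually.of_forall fun n => by fun_prop) (Eventually.of_forall fun n => ?_)
    (hG.const_mul 4) (Eventually.of_forall fun s => ?_)
  · refine Eventually.of_forall fun s => ?_
    rw [Real.norm_eq_abs, abs_of_nonneg (sq_nonneg _)]
    have h3 := abs_le.mp (hfG n.1 s)
    have h4 := abs_le.mp (hfG n.2 s)
    have h5 : |f n.1 s - f n.2 s| ≤ 2 * G s := abs_le.mpr ⟨by linarith, by linarith⟩
    calc (f n.1 s - f n.2 s) ^ 2 = |f n.1 s - f n.2 s| ^ 2 := (sq_abs _).symm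
      _ ≤ (2 * G s) ^ 2 := by gcongr
      _ = 4 * G s ^ 2 := by ring
  · rw [← prod_atTop_atTop_eq]
    have h3 : Tendsto (fun n : ℕ × ℕ => (f n.1 s - f n.2 s) ^ 2) (atTop ×ˢ atTop)
        (𝓝 ((F s - F s) ^ 2)) :=
      (((hfF s).comp tendsto_fst).sub ((hfF s).comp tendsto_snd)).pow 2
    simpa using h3

/-- `P` is the spectral projection of the representation `π` that belongs to the set `s`. -/
def IsSpectralProjection (s : Set X) (P : H →L[ℂ] H) : Prop :=
  IsStarProjection P ∧
    ∀ f x, ⟪x, P (π f x)⟫_ℂ = ((∫ t in s, f t ∂(calculusMeasure π x) : ℝ) : ℂ)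

variable {π}

namespace IsSpectralProjection

variable {s t : Set X} {P Q : H →L[ℂ] H}

theorem inner_self (hP : IsSpectralProjection π s P) (x : H) :
    ⟪x, P x⟫_ℂ = (((calculusMeasure π x).real s : ℝ) : ℂ) := by
  have h := hP.2 1 x
  rw [calculus_one_apply] at h
  rw [h]
  simp

theorem eq (hP : IsSpectralProjection π s P) (hQ : IsSpectralProjection π s Q) : P = Q :=
  eq_of_forall_inner_self_eq fun x => by rw [hP.inner_self, hQ.inner_self]

theorem apply_apply (hP : IsSpectralProjection π s P) (x : H) : P (P x) = P x :=
  congrArg (fun P : H →L[ℂ] H => P x) hP.1.isIdempotentElem.eq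

theorem inner_left (hP : IsSpectralProjection π s P) (x y : H) : ⟪P x, y⟫_ℂ = ⟪x, P y⟫_ℂ :=
  inner_apply_eq_of_isSelfAdjoint hP.1.isSelfAdjoint x y

theorem norm_sq (hP : IsSpectralProjection π s P) (x : H) :
    ‖P x‖ ^ 2 = (calculusMeasure π x).real s := by
  have h := hP.inner_self x
  rw [← hP.apply_apply, ← hP.inner_left, inner_self_eq_norm_sq_to_K] at h
  exact Complex.ofReal_injective ((Complex.ofReal_pow _ _).trans h)

/-- The quadratic form of `P π(f)` is real, so this product of self-adjoint operators is
self-adjoint, which means that the factors commute. This is why `IsSpectralProjection` tests against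
all `f`, not only against `1`. -/
theorem commute (hP : IsSpectralProjection π s P) (f : C(X, ℝ)) (x : H) :
    P (π f x) = π f (P x) := by
  have h : IsSelfAdjoint (P * π f) := isSelfAdjoint_of_inner_self_eq_ofReal (hP.2 f)
  have h' : star (P * π f) = P * π f := h
  rw [star_mul, (isSelfAdjoint_calculus π f).star_eq, hP.1.isSelfAdjoint.star_eq] at h'
  exact (congrArg (fun P : H →L[ℂ] H => P x) h').symm

theorem inner_proj_calculus_proj (hP : IsSpectralProjection π s P) (f : C(X, ℝ)) (x : H) :
    ⟪P x, π f (P x)⟫_ℂ = ((∫ t in s, f t ∂(calculusMeasure π x) : ℝ) : ℂ) := by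
  rw [hP.inner_left, ← hP.commute, hP.apply_apply, hP.2]

/-- Cutting a vector by `P` cuts its measure to `s`. Orthogonality of projections for disjoint sets
follows from this. -/
theorem calculusMeasure_proj [HasOuterApproxClosed X] (hP : IsSpectralProjection π s P) (x : H) :
    calculusMeasure π (P x) = (calculusMeasure π x).restrict s := by
  refine ext_of_forall_integral_eq_of_IsFiniteMeasure fun f => ?_
  change ∫ t, f.toContinuousMap t ∂_ = ∫ t in s, f.toContinuousMap t ∂_
  rw [integral_calculusMeasure, hP.inner_proj_calculus_proj, Complex.ofReal_re]

theorem apply_apply_of_disjoint [HasOuterApproxClosed X] (hP : IsSpectralProjection π s P)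
    (hQ : IsSpectralProjection π t Q) (hs : MeasurableSet s) (hst : Disjoint s t) (x : H) :
    P (Q x) = 0 := by
  have h := hP.norm_sq (Q x)
  rw [hQ.calculusMeasure_proj, measureReal_restrict_apply hs, hst.inter_eq, measureReal_empty] at h
  exact norm_eq_zero.mp (pow_eq_zero_iff two_ne_zero |>.mp h)

/-- Strong limits preserve the defining formula. Idempotence comes from the two limits `‖P x‖² =
μ(s)` and `⟪x, P x⟫ = μ(s)`: together with self-adjointness they give `⟪x, P² x⟫ = ⟪x, P x⟫` for all
`x`. -/
theorem of_tendsto {Q : ℕ → H →L[ℂ] H} (hQ : ∀ x, ∃ v, Tendsto (fun n => Q n x) atTop (𝓝 v))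
    (hinner : ∀ f x, Tendsto (fun n => ⟪x, Q n (π f x)⟫_ℂ) atTop
      (𝓝 ((∫ t in s, f t ∂(calculusMeasure π x) : ℝ) : ℂ)))
    (hnorm : ∀ x, Tendsto (fun n => ‖Q n x‖ ^ 2) atTop (𝓝 ((calculusMeasure π x).real s))) :
    ∃ P, IsSpectralProjection π s P ∧ ∀ x, Tendsto (fun n => Q n x) atTop (𝓝 (P x)) := by
  choose v hv using hQ
  let P : H →L[ℂ] H := continuousLinearMapOfTendsto Q (tendsto_pi_nhds.mpr hv)
  have hP : ∀ x, Tendsto (fun n => Q n x) atTop (𝓝 (P x)) := hv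
  have h1 : ∀ f x, ⟪x, P (π f x)⟫_ℂ = ((∫ t in s, f t ∂(calculusMeasure π x) : ℝ) : ℂ) :=
    fun f x => tendsto_nhds_unique
      ((continuous_const.inner continuous_id).continuousAt.tendsto.comp (hP (π f x))) (hinner f x)
  have h2 : ∀ x, ⟪x, P x⟫_ℂ = (((calculusMeasure π x).real s : ℝ) : ℂ) := by
    intro x
    have h := h1 1 x
    rw [calculus_one_apply] at h
    rw [h]
    simp
  have hsa : IsSelfAdjoint P := isSelfAdjoint_of_inner_self_eq_ofReal h2
  refine ⟨P, ⟨⟨eq_of_forall_inner_self_eq fun x => ?_, hsa⟩, h1⟩, hP⟩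
  have h3 : ‖P x‖ ^ 2 = (calculusMeasure π x).real s :=
    tendsto_nhds_unique ((hP x).norm.pow 2) (hnorm x)
  change ⟪x, P (P x)⟫_ℂ = _
  rw [h2, ← inner_apply_eq_of_isSelfAdjoint hsa, inner_self_eq_norm_sq_to_K, ← h3]
  norm_cast

theorem empty : IsSpectralProjection π ∅ 0 :=
  ⟨IsStarProjection.zero _, fun f x => by simp⟩

theorem univ : IsSpectralProjection π Set.univ 1 :=
  ⟨IsStarProjection.one _, fun f x => by
    rw [Measure.restrict_univ, ← inner_self_calculus_eq_integral]; rfl⟩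

theorem compl (hP : IsSpectralProjection π s P) (hs : MeasurableSet s) :
    IsSpectralProjection π sᶜ (1 - P) := by
  refine ⟨hP.1.one_sub, fun f x => ?_⟩
  rw [sub_apply, inner_sub_right, hP.2, setIntegral_compl hs (integrable_calculusMeasure π f x),
    one_apply_eq_self, inner_self_calculus_eq_integral, Complex.ofReal_sub]

/-- The vectors `Q i x` are mutually orthogonal, so by Pythagoras the vector series is Cauchy
because the series of the measures of the `S i` converges. -/
theorem hasSum [HasOuterApproxClosed X] {S : ℕ → Set X} {Q : ℕ → H →L[ℂ] H}
    (hS : ∀ i, MeasurableSet (S i)) (hd : Pairwise (Function.onFun Disjoint S))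
    (hQ : ∀ i, IsSpectralProjection π (S i) (Q i)) :
    ∃ P, IsSpectralProjection π (⋃ i, S i) P ∧ ∀ x, HasSum (fun i => Q i x) (P x) := by
  have hmeas : ∀ x, HasSum (fun i => (calculusMeasure π x).real (S i))
      ((calculusMeasure π x).real (⋃ i, S i)) := by
    intro x
    have := hasSum_integral_iUnion (μ := calculusMeasure π x) (f := fun _ => (1 : ℝ)) hS hd
      (integrable_const _)
    simpa using this
  have hpyth : ∀ (F : Finset ℕ) x, ‖∑ i ∈ F, Q i x‖ ^ 2 =
      ∑ i ∈ F, (calculusMeasure π x).real (S i) := by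
    intro F x
    have h : ⟪∑ i ∈ F, Q i x, ∑ i ∈ F, Q i x⟫_ℂ =
        ((∑ i ∈ F, (calculusMeasure π x).real (S i) : ℝ) : ℂ) := by
      rw [sum_inner, Complex.ofReal_sum]
      refine Finset.sum_congr rfl fun i hi => ?_
      rw [inner_sum, Finset.sum_eq_single_of_mem i hi, (hQ i).inner_left, (hQ i).apply_apply,
        (hQ i).inner_self]
      intro j _ hji
      rw [(hQ i).inner_left, (hQ i).apply_apply_of_disjoint (hQ j) (hS i) (hd hji.symm),
        inner_zero_right]
    rw [inner_self_eq_norm_sq_to_K] at h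
    exact Complex.ofReal_injective ((Complex.ofReal_pow _ _).trans h)
  have hsum : ∀ x, Summable fun i => Q i x := by
    intro x
    rw [summable_iff_vanishing_norm]
    intro ε hε
    obtain ⟨F, hF⟩ := summable_iff_vanishing_norm.mp (hmeas x).summable (ε ^ 2) (by positivity)
    refine ⟨F, fun t ht => ?_⟩
    have h := hF t ht
    rw [← hpyth, Real.norm_eq_abs, abs_of_nonneg (sq_nonneg _)] at h
    exact lt_of_pow_lt_pow_left₀ 2 hε.le h
  obtain ⟨P, hP, hPt⟩ := of_tendsto (π := π) (s := ⋃ i, S i)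
    (Q := fun n => ∑ i ∈ Finset.range n, Q i)
    (fun x => ⟨_, by simpa using (hsum x).hasSum.tendsto_sum_nat⟩)
    (fun f x => by
      have h := (hasSum_integral_iUnion hS hd
        (integrable_calculusMeasure π f x).integrableOn).tendsto_sum_nat
      have h' := (Complex.continuous_ofReal.tendsto _).comp h
      refine h'.congr fun n => ?_
      simp only [Function.comp_apply, sum_apply, inner_sum, (hQ _).2, Complex.ofReal_sum])
    (fun x => by
      refine (hmeas x).tendsto_sum_nat.congr fun n => ?_
      rw [sum_apply, hpyth])
  refine ⟨P, hP, fun x => ?_⟩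
  have h := (hsum x).hasSum
  have h' : Tendsto (fun n => ∑ i ∈ Finset.range n, Q i x) atTop (𝓝 (P x)) := by
    simpa using hPt x
  rwa [tendsto_nhds_unique h.tendsto_sum_nat h'] at h

/-- The indicator of a closed set is a pointwise limit of continuous functions with values in `[0,
1]`, so its projection is a strong limit of the functional calculus. -/
theorem exists_of_isClosed [HasOuterApproxClosed X] (hs : _root_.IsClosed s) :
    ∃ P, IsSpectralProjection π s P := by
  let f : ℕ → C(X, ℝ) := fun n => ⟨fun x => (hs.apprSeq n x : ℝ), by fun_prop⟩
  have hf0 : ∀ n x, 0 ≤ f n x := fun n x => NNReal.coe_nonneg _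
  have hf1 : ∀ n x, f n x ≤ 1 := fun n x =>
    NNReal.coe_le_one.mpr (HasOuterApproxClosed.apprSeq_apply_le_one hs n x)
  have hfa : ∀ n x, |f n x| ≤ 1 := fun n x => abs_le.mpr ⟨by linarith [hf0 n x], hf1 n x⟩
  have hlim : ∀ x, Tendsto (fun n => f n x) atTop (𝓝 (s.indicator (fun _ => (1 : ℝ)) x)) := by
    intro x
    have h := tendsto_pi_nhds.mp (HasOuterApproxClosed.tendsto_apprSeq hs) x
    have h' := (NNReal.continuous_coe.tendsto _).comp h
    refine h'.trans (le_of_eq ?_)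
    by_cases hx : x ∈ s <;> simp [hx]
  have hint : ∀ (g : C(X, ℝ)) (x : H), Tendsto (fun n => ∫ t, f n t * g t ∂(calculusMeasure π x))
      atTop (𝓝 (∫ t in s, g t ∂(calculusMeasure π x))) := by
    intro g x
    rw [← integral_indicator hs.measurableSet]
    refine tendsto_integral_of_dominated_convergence (fun t => |g t|) (fun n => by fun_prop)
      (integrable_calculusMeasure π g x).abs (fun n => Eventually.of_forall fun t => ?_)
      (Eventually.of_forall fun t => ?_)
    · rw [norm_mul, Real.norm_eq_abs, Real.norm_eq_abs]
      exact mul_le_of_le_one_left (abs_nonneg _) (hfa n t)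
    · have := (hlim t).mul_const (g t)
      refine this.trans (le_of_eq ?_)
      by_cases hx : t ∈ s <;> simp [hx]
  obtain ⟨P, hP, -⟩ := of_tendsto (π := π) (s := s) (Q := fun n => π (f n))
    (fun x => exists_tendsto_calculus π (G := fun _ => 1) (integrable_const _) hfa hlim)
    (fun g x => by
      refine ((Complex.continuous_ofReal.tendsto _).comp (hint g x)).congr fun n => ?_
      rw [← calculus_mul_apply, inner_self_calculus_eq_integral]
      rfl)
    (fun x => by
      have h1 : Tendsto (fun n => ∫ t, f n t ^ 2 ∂(calculusMeasure π x)) atTop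
          (𝓝 (∫ t, s.indicator (fun _ => (1 : ℝ)) t ∂(calculusMeasure π x))) := by
        refine tendsto_integral_of_dominated_convergence (fun t => 1) (fun n => by fun_prop)
          (integrable_const _) (fun n => Eventually.of_forall fun t => ?_)
          (Eventually.of_forall fun t => ?_)
        · rw [norm_pow, Real.norm_eq_abs]
          exact pow_le_one₀ (abs_nonneg _) (hfa n t)
        · refine ((hlim t).pow 2).trans (le_of_eq ?_)
          by_cases hx : t ∈ s <;> simp [hx]
      rw [integral_indicator hs.measurableSet] at h1
      simp only [integral_const, measureReal_restrict_apply MeasurableSet.univ, Set.univ_inter,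
        smul_eq_mul, mul_one] at h1
      refine h1.congr fun n => ?_
      rw [norm_sq_calculus_eq_integral])
  exact ⟨P, hP⟩

/-- Dynkin's π-λ argument: closed sets form a generating π-system, and the sets having a projection
are stable under complements and countable disjoint unions. -/
theorem exists_of_measurableSet [HasOuterApproxClosed X] (hs : MeasurableSet s) :
    ∃ P, IsSpectralProjection π s P := by
  refine MeasurableSpace.induction_on_inter (C := fun s _ => ∃ P, IsSpectralProjection π s P)
    (BorelSpace.measurable_eq.trans borel_eq_generateFrom_isClosed) isPiSystem_isClosed
    ⟨0, empty⟩ (fun t ht => exists_of_isClosed ht) (fun t ht ⟨P, hP⟩ => ⟨1 - P, hP.compl ht⟩)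
    (fun S hd hS ih => ?_) s hs
  choose Q hQ using ih
  obtain ⟨P, hP, -⟩ := hasSum hS hd hQ
  exact ⟨P, hP⟩

end IsSpectralProjection

end FunctionalCalculus

/-! ### Projection-valued measures and supports of their compressions -/

section ProjectionMeasure

open Filter Topology

variable {H : Type*} [NormedAddCommGroup H] [InnerProductSpace ℂ H] [CompleteSpace H]
  {X : Type*} [TopologicalSpace X] [CompactSpace X] [T2Space X] [HasOuterApproxClosed X]
  [MeasurableSpace X] [BorelSpace X]

/-- The spectral projection of the representation `π` for a measurable set. -/
def spectralProjection (π : C(X, ℝ) →⋆ₐ[ℝ] (H →L[ℂ] H)) {s : Set X} (hs : MeasurableSet s) :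
    H →L[ℂ] H :=
  (IsSpectralProjection.exists_of_measurableSet (π := π) hs).choose

theorem isSpectralProjection_spectralProjection (π : C(X, ℝ) →⋆ₐ[ℝ] (H →L[ℂ] H)) {s : Set X}
    (hs : MeasurableSet s) : IsSpectralProjection π s (spectralProjection π hs) :=
  (IsSpectralProjection.exists_of_measurableSet (π := π) hs).choose_spec

open Classical in
/-- The push-forward along `φ` of the projection-valued measure of the representation `π`. -/
def calculusProjectionMeasure (π : C(X, ℝ) →⋆ₐ[ℝ] (H →L[ℂ] H)) {φ : X → ℝ} (hφ : Measurable φ) :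
    ProjectionMeasure H where
  proj s := if hs : MeasurableSet s then spectralProjection π (hφ hs) else 0
  isStarProjection s hs := by
    rw [dif_pos hs]
    exact (isSpectralProjection_spectralProjection π (hφ hs)).1
  proj_empty := by
    rw [dif_pos MeasurableSet.empty]
    exact (isSpectralProjection_spectralProjection π (hφ MeasurableSet.empty)).eq
      IsSpectralProjection.empty
  proj_univ := by
    rw [dif_pos MeasurableSet.univ]
    exact (isSpectralProjection_spectralProjection π (hφ MeasurableSet.univ)).eq
      IsSpectralProjection.univ
  hasSum_proj s hs hd x := by
    obtain ⟨P, hP, hsum⟩ := IsSpectralProjection.hasSum (π := π) (fun i => hφ (hs i))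
      (fun i j hij => (hd hij).preimage φ)
      (fun i => isSpectralProjection_spectralProjection π (hφ (hs i)))
    have h := isSpectralProjection_spectralProjection π (hφ (MeasurableSet.iUnion hs))
    rw [← Set.preimage_iUnion] at hP
    rw [dif_pos (MeasurableSet.iUnion hs), h.eq hP]
    simpa only [dif_pos (hs _)] using hsum x

theorem isSpectralProjection_calculusProjectionMeasure (π : C(X, ℝ) →⋆ₐ[ℝ] (H →L[ℂ] H))
    {φ : X → ℝ} (hφ : Measurable φ) {s : Set ℝ} (hs : MeasurableSet s) :
    IsSpectralProjection π (φ ⁻¹' s) ((calculusProjectionMeasure π hφ).proj s) := by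
  have h : (calculusProjectionMeasure π hφ).proj s = spectralProjection π (hφ hs) := dif_pos hs
  rw [h]
  exact isSpectralProjection_spectralProjection π (hφ hs)

theorem scalarMeasure_calculusProjectionMeasure (π : C(X, ℝ) →⋆ₐ[ℝ] (H →L[ℂ] H))
    {φ : X → ℝ} (hφ : Measurable φ) (x : H) :
    (calculusProjectionMeasure π hφ).scalarMeasure x = (calculusMeasure π x).map φ := by
  ext s hs
  rw [ProjectionMeasure.scalarMeasure_apply _ _ hs, Measure.map_apply hφ hs,
    (isSpectralProjection_calculusProjectionMeasure π hφ hs).norm_sq, ofReal_measureReal]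

/-- Each point off the support has a null open neighbourhood, and in a second countable space a
locally null set is null. -/
theorem ProjectionMeasure.ae_mem_compressedSupport {K : Type*} [NormedAddCommGroup K]
    [InnerProductSpace ℂ K] [CompleteSpace K] (E : ProjectionMeasure H) (V : K →L[ℂ] H) (x : K) :
    ∀ᵐ t ∂(E.scalarMeasure (V x)), t ∈ E.compressedSupport V := by
  rw [ae_iff]
  refine measure_null_of_locally_null _ fun t ht => ?_
  simp only [compressedSupport, Set.mem_ofPred_eq, not_forall, not_not] at ht
  obtain ⟨U, hU, htU, h0⟩ := ht
  refine ⟨U, mem_nhdsWithin_of_mem_nhds (hU.mem_nhds htU), ?_⟩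
  have h1 : ⟪V x, E.proj U (V x)⟫_ℂ = 0 := by
    rw [← ContinuousLinearMap.adjoint_inner_right]
    change ⟪x, ((ContinuousLinearMap.adjoint V) ∘L (E.proj U) ∘L V) x⟫_ℂ = 0
    rw [h0]
    simp
  rw [E.inner_proj_self hU.measurableSet] at h1
  rw [E.scalarMeasure_apply _ hU.measurableSet, Complex.ofReal_eq_zero.mp h1, ENNReal.ofReal_zero]

theorem ProjectionMeasure.isClosed_compressedSupport {K : Type*} [NormedAddCommGroup K]
    [InnerProductSpace ℂ K] [CompleteSpace K] (E : ProjectionMeasure H) (V : K →L[ℂ] H) :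
    _root_.IsClosed (E.compressedSupport V) := by
  rw [← isOpen_compl_iff, isOpen_iff_mem_nhds]
  intro t ht
  simp only [compressedSupport, Set.mem_compl_iff, Set.mem_ofPred_eq, not_forall, not_not] at ht
  obtain ⟨U, hU, htU, h0⟩ := ht
  exact mem_of_superset (hU.mem_nhds htU) fun u hu h => h U hU hu h0

end ProjectionMeasure

/-! ### The spectral measure of `A` obtained from `T = A⁻¹` -/

section InverseOperator

open Filter Topology

variable {H : Type*} [NormedAddCommGroup H] [InnerProductSpace ℂ H] [CompleteSpace H]
  {A : H →ₗ.[ℂ] H} {T : H →L[ℂ] H}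

theorem IsBoundedInverseAt.apply_map {H : Type*} [NormedAddCommGroup H] [NormedSpace ℂ H]
    {A : H →ₗ.[ℂ] H} {T : H →L[ℂ] H} (hT : IsBoundedInverseAt A 0 T) (x : A.domain) :
    T (A x) = x := by
  simpa using hT.1 x

theorem IsBoundedInverseAt.exists_map_eq {H : Type*} [NormedAddCommGroup H] [NormedSpace ℂ H]
    {A : H →ₗ.[ℂ] H} {T : H →L[ℂ] H} (hT : IsBoundedInverseAt A 0 T) (y : H) :
    ∃ x : A.domain, (x : H) = T y ∧ A x = y := by
  simpa using hT.2 y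

theorem IsBoundedInverseAt.eq_zero {H : Type*} [NormedAddCommGroup H] [NormedSpace ℂ H]
    {A : H →ₗ.[ℂ] H} {T : H →L[ℂ] H} (hT : IsBoundedInverseAt A 0 T) {y : H} (hy : T y = 0) :
    y = 0 := by
  obtain ⟨x, hx, hxy⟩ := hT.exists_map_eq y
  rw [hy] at hx
  rw [← hxy, Subtype.ext hx (a2 := (0 : A.domain)), A.map_zero]

theorem IsBoundedInverseAt.isSelfAdjoint (hA : IsSelfAdjoint A) (hT : IsBoundedInverseAt A 0 T) :
    IsSelfAdjoint T := by
  rw [ContinuousLinearMap.isSelfAdjoint_iff_isSymmetric]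
  intro x y
  obtain ⟨u, hu, hux⟩ := hT.exists_map_eq x
  obtain ⟨v, hv, hvy⟩ := hT.exists_map_eq y
  change ⟪T x, y⟫_ℂ = ⟪x, T y⟫_ℂ
  rw [← hu, ← hv, ← hux, ← hvy, inner_map_eq_of_isSelfAdjoint hA]

/-- The identity function on the real spectrum of `T`. -/
def spectrumId (T : H →L[ℂ] H) : C(_root_.spectrum ℝ T, ℝ) := ⟨fun s => (s : ℝ), by fun_prop⟩

theorem cfcHom_spectrumId (hsa : IsSelfAdjoint T) : cfcHom (R := ℝ) hsa (spectrumId T) = T :=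
  cfcHom_id hsa

/-- `T` annihilates the range of the projection for `{0}`, but `T` is injective. So the convention
`0⁻¹ = 0` does not create an atom at `0` when measures are pushed forward along `s ↦ s⁻¹`. -/
theorem calculusMeasure_singleton_zero (hT : IsBoundedInverseAt A 0 T) (hsa : IsSelfAdjoint T)
    (x : H) : calculusMeasure (cfcHom (R := ℝ) hsa) x
      {s : _root_.spectrum ℝ T | (s : ℝ) = 0} = 0 := by
  have hm : MeasurableSet {s : _root_.spectrum ℝ T | (s : ℝ) = 0} :=
    measurable_subtype_coe (measurableSet_singleton (0 : ℝ))
  obtain ⟨P, hP⟩ := IsSpectralProjection.exists_of_measurableSet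
    (π := cfcHom (R := ℝ) hsa) hm
  have h1 := norm_sq_calculus_eq_integral (cfcHom (R := ℝ) hsa) (spectrumId T) (P x)
  rw [hP.calculusMeasure_proj, cfcHom_spectrumId,
    setIntegral_congr_fun (g := fun _ => (0 : ℝ)) hm fun s hs => by
      change (s : ℝ) ^ 2 = 0
      rw [show (s : ℝ) = 0 from hs]; norm_num, integral_zero] at h1
  have h2 := hP.norm_sq x
  rw [hT.eq_zero (norm_eq_zero.mp (pow_eq_zero_iff two_ne_zero |>.mp h1)), norm_zero] at h2
  rw [← measureReal_eq_zero_iff, ← h2]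
  norm_num

/-- Both measures integrate `f` to `⟪T w, f(T) T w⟫ = ⟪w, (T f(T) T) w⟫`. -/
theorem calculusMeasure_apply_eq_withDensity (hsa : IsSelfAdjoint T) (w : H) :
    calculusMeasure (cfcHom (R := ℝ) hsa) (T w) =
      (calculusMeasure (cfcHom (R := ℝ) hsa) w).withDensity
        fun s => ENNReal.ofReal ((s : ℝ) ^ 2) := by
  have hfin : IsFiniteMeasure ((calculusMeasure (cfcHom (R := ℝ) hsa) w).withDensity
        fun s => ENNReal.ofReal ((s : ℝ) ^ 2)) :=
    isFiniteMeasure_withDensity_ofReal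
      (integrable_calculusMeasure _ (spectrumId T * spectrumId T) w |>.congr
        (Eventually.of_forall fun s => (sq (s : ℝ)).symm)).2
  refine ext_of_forall_integral_eq_of_IsFiniteMeasure fun f => ?_
  rw [integral_withDensity_eq_integral_toReal_smul (by fun_prop)
    (Eventually.of_forall fun _ => ENNReal.ofReal_lt_top)]
  have h := integral_calculusMeasure (cfcHom (R := ℝ) hsa)
    (spectrumId T * (f.toContinuousMap * spectrumId T)) w
  rw [calculus_mul_apply, calculus_mul_apply, ← inner_calculus_left, cfcHom_spectrumId,
    ← integral_calculusMeasure] at h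
  refine h.symm.trans (integral_congr_ae (Eventually.of_forall fun s => ?_))
  change (s : ℝ) * (f s * (s : ℝ)) = (ENNReal.ofReal ((s : ℝ) ^ 2)).toReal * f s
  rw [ENNReal.toReal_ofReal (sq_nonneg _)]
  ring

theorem exists_apply_eq_of_integrable (hT : IsBoundedInverseAt A 0 T) (hsa : IsSelfAdjoint T)
    {x : H} (hx : Integrable (fun s : _root_.spectrum ℝ T => ((s : ℝ)⁻¹) ^ 2)
      (calculusMeasure (cfcHom (R := ℝ) hsa) x)) : ∃ w, T w = x := by
  have hpos : ∀ (n : ℕ) (s : ℝ), 0 < s ^ 2 + 1 / ((n : ℝ) + 1) := fun n s => by positivity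
  -- Continuous regularizations of `s⁻¹`, dominated by `|s⁻¹|`. The vectors `f n (T) x` converge to
  -- the preimage `w`, since `s f n (s)` lies in `[0, 1]` and tends to `1` off the null set `{0}`.
  let f : ℕ → C(_root_.spectrum ℝ T, ℝ) := fun n =>
    ⟨fun s => (s : ℝ) / ((s : ℝ) ^ 2 + 1 / ((n : ℝ) + 1)),
      Continuous.div (by fun_prop) (by fun_prop) fun s => (hpos n s).ne'⟩
  have hfs : ∀ n s, f n s = (s : ℝ) / ((s : ℝ) ^ 2 + 1 / ((n : ℝ) + 1)) := fun _ _ => rfl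
  have hle : ∀ n s, |f n s| ≤ |(s : ℝ)⁻¹| := by
    intro n s
    rw [hfs, abs_div, abs_of_pos (hpos n s), abs_inv]
    by_cases hs : (s : ℝ) = 0
    · simp [hs]
    · rw [div_le_iff₀ (hpos n s), ← sq_abs (s : ℝ), mul_add, sq, inv_mul_cancel_left₀
        (abs_ne_zero.mpr hs)]
      exact le_add_of_nonneg_right (by positivity)
  have hlim : ∀ s, Tendsto (fun n => f n s) atTop (𝓝 (s : ℝ)⁻¹) := by
    intro s
    simp only [hfs]
    by_cases hs : (s : ℝ) = 0
    · simp [hs]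
    · have h : Tendsto (fun n : ℕ => (s : ℝ) / ((s : ℝ) ^ 2 + 1 / ((n : ℝ) + 1))) atTop
          (𝓝 ((s : ℝ) / ((s : ℝ) ^ 2 + 0))) :=
        tendsto_const_nhds.div (tendsto_const_nhds.add tendsto_one_div_add_atTop_nhds_zero_nat)
          (by simpa using hs)
      refine h.trans (le_of_eq ?_)
      congr 1
      field_simp
      simp
  obtain ⟨w, hw⟩ := exists_tendsto_calculus (cfcHom (R := ℝ) hsa) (G := fun s => |(s : ℝ)⁻¹|)
    (by simpa only [sq_abs] using hx) hle hlim
  refine ⟨w, ?_⟩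
  have h1 : Tendsto (fun n => T (cfcHom (R := ℝ) hsa (f n) x)) atTop (𝓝 (T w)) :=
    (T.continuous.tendsto w).comp hw
  refine tendsto_nhds_unique h1 ?_
  rw [tendsto_iff_norm_sub_tendsto_zero]
  have h2 : ∀ n, ‖T (cfcHom (R := ℝ) hsa (f n) x) - x‖ =
      √(∫ s, ((s : ℝ) * f n s - 1) ^ 2 ∂(calculusMeasure (cfcHom (R := ℝ) hsa) x)) := by
    intro n
    have h := norm_sq_calculus_eq_integral (cfcHom (R := ℝ) hsa) (spectrumId T * f n - 1) x
    rw [map_sub, sub_apply, calculus_mul_apply, calculus_one_apply, cfcHom_spectrumId] at h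
    rw [← Real.sqrt_sq (norm_nonneg _), h]
    rfl
  simp_rw [h2]
  rw [← Real.sqrt_zero]
  refine (Real.continuous_sqrt.tendsto 0).comp ?_
  have h3 : ∫ _, (0 : ℝ) ∂(calculusMeasure (cfcHom (R := ℝ) hsa) x) = 0 := by simp
  rw [← h3]
  refine tendsto_integral_of_dominated_convergence (fun _ => 1) (fun n => by fun_prop)
    (integrable_const _) (fun n => Eventually.of_forall fun s => ?_) ?_
  · have h4 : 0 ≤ (s : ℝ) * f n s := by
      rw [hfs, ← mul_div_assoc]
      exact div_nonneg (mul_self_nonneg _) (hpos n s).le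
    have h5 : (s : ℝ) * f n s ≤ 1 := by
      rw [hfs, ← mul_div_assoc, div_le_one (hpos n s), ← sq]
      exact le_add_of_nonneg_right (by positivity)
    rw [norm_pow, Real.norm_eq_abs]
    exact pow_le_one₀ (abs_nonneg _) (abs_le.mpr ⟨by linarith, by linarith⟩)
  · have h0 : ∀ᵐ s : _root_.spectrum ℝ T ∂(calculusMeasure (cfcHom (R := ℝ) hsa) x),
        (s : ℝ) ≠ 0 := by
      rw [ae_iff]
      simpa using calculusMeasure_singleton_zero hT hsa x
    filter_upwards [h0] with s hs
    have := (((hlim s).const_mul (s : ℝ)).sub_const 1).pow 2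
    rw [mul_inv_cancel₀ hs] at this
    simpa using this

theorem measurable_inv_spectrum {H : Type*} [NormedAddCommGroup H] [InnerProductSpace ℂ H]
    {T : H →L[ℂ] H} :
    Measurable fun s : _root_.spectrum ℝ T => (s : ℝ)⁻¹ :=
  measurable_subtype_coe.inv

/-- The spectral measure of the inverse of `T`. -/
def inverseSpectralMeasure (hsa : IsSelfAdjoint T) : ProjectionMeasure H :=
  calculusProjectionMeasure (cfcHom (R := ℝ) hsa) (measurable_inv_spectrum (T := T))

/-- Writing a domain vector as `x = T w` multiplies the measure of `w` by `s²`. This cancels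
`(s⁻¹)²`, giving integrability, and turns `∫ s⁻¹` into `∫ s = ⟪w, T w⟫`. The converse on the domain
is `exists_apply_eq_of_integrable`. -/
theorem isSpectralMeasureOf_inverseSpectralMeasure (hT : IsBoundedInverseAt A 0 T)
    (hsa : IsSelfAdjoint T) : (inverseSpectralMeasure hsa).IsSpectralMeasureOf A := by
  have hdom : ∀ w, Integrable (fun s : _root_.spectrum ℝ T => ((s : ℝ)⁻¹) ^ 2)
      (calculusMeasure (cfcHom (R := ℝ) hsa) (T w)) := by
    intro w
    rw [calculusMeasure_apply_eq_withDensity, integrable_withDensity_iff_integrable_smul'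
      (by fun_prop) (Eventually.of_forall fun _ => ENNReal.ofReal_lt_top)]
    refine (integrable_const (1 : ℝ)).mono' (by fun_prop) (Eventually.of_forall fun s => ?_)
    rw [ENNReal.toReal_ofReal (sq_nonneg _), smul_eq_mul, ← mul_pow, norm_pow]
    by_cases hs : (s : ℝ) = 0 <;> simp [hs]
  refine ⟨fun x => ?_, fun x => ?_⟩
  · rw [inverseSpectralMeasure, scalarMeasure_calculusProjectionMeasure,
      integrable_map_measure (by fun_prop) measurable_inv_spectrum.aemeasurable]
    refine ⟨fun hx => ?_, fun hx => ?_⟩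
    · have := hdom (A ⟨x, hx⟩)
      rwa [hT.apply_map] at this
    · obtain ⟨w, hw⟩ := exists_apply_eq_of_integrable hT hsa hx
      obtain ⟨u, hu, -⟩ := hT.exists_map_eq w
      rw [← hw, ← hu]
      exact u.2
  · rw [inverseSpectralMeasure, scalarMeasure_calculusProjectionMeasure,
      integral_map measurable_inv_spectrum.aemeasurable (by fun_prop)]
    have hx := hT.apply_map x
    nth_rewrite 2 [← hx]
    rw [calculusMeasure_apply_eq_withDensity, integral_withDensity_eq_integral_toReal_smul
      (by fun_prop) (Eventually.of_forall fun _ => ENNReal.ofReal_lt_top)]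
    have h := inner_self_calculus_eq_integral (cfcHom (R := ℝ) hsa) (spectrumId T) (A x)
    rw [cfcHom_spectrumId, ← inner_apply_eq_of_isSelfAdjoint hsa, hx] at h
    rw [h]
    congr 1
    refine integral_congr_ae (Eventually.of_forall fun s => ?_)
    change (s : ℝ) = (ENNReal.ofReal ((s : ℝ) ^ 2)).toReal * (s : ℝ)⁻¹
    rw [ENNReal.toReal_ofReal (sq_nonneg _)]
    by_cases hs : (s : ℝ) = 0
    · simp [hs]
    · field_simp

theorem inv_notMem_spectrum {H : Type*} [NormedAddCommGroup H] [InnerProductSpace ℂ H]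
    {A : H →ₗ.[ℂ] H} {T : H →L[ℂ] H} (hT : IsBoundedInverseAt A 0 T) {t : ℝ} (ht : t ≠ 0)
    (htA : (t : ℂ) ∈ resolventSet A) : t⁻¹ ∉ _root_.spectrum ℝ T := by
  obtain ⟨R, hR⟩ := htA
  have hR1 : ∀ w, R (w - (t : ℂ) • T w) = T w := by
    intro w
    obtain ⟨u, hu, huw⟩ := hT.exists_map_eq w
    have := hR.1 u
    rwa [hu, huw] at this
  have hR2 : ∀ w, T (w + (t : ℂ) • R w) = R w := by
    intro w
    obtain ⟨u, hu, huw⟩ := hR.2 w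
    have := hT.apply_map u
    rw [eq_add_of_sub_eq huw, hu] at this
    exact this
  rw [_root_.spectrum.notMem_iff]
  have htc : (t : ℂ) ≠ 0 := by exact_mod_cast ht
  have hF : ∀ v, (algebraMap ℝ (H →L[ℂ] H) t⁻¹ - T) v = (t : ℂ)⁻¹ • v - T v := by
    intro v
    rw [sub_apply, Algebra.algebraMap_eq_smul_one, smul_apply, ← Complex.coe_smul,
      Complex.ofReal_inv, one_apply_eq_self]
  -- From `t⁻¹ - T = t⁻¹ (A - t) A⁻¹` the inverse is `t A (A - t)⁻¹ = t (1 + t R)`.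
  refine ⟨⟨_, (t : ℂ) • (1 + (t : ℂ) • R), ?_, ?_⟩, rfl⟩
  · ext w
    change (algebraMap ℝ (H →L[ℂ] H) t⁻¹ - T) ((t : ℂ) • (w + (t : ℂ) • R w)) = w
    rw [hF, map_smul, hR2, inv_smul_smul₀ htc, add_sub_cancel_right]
  · ext w
    change (t : ℂ) • ((algebraMap ℝ (H →L[ℂ] H) t⁻¹ - T) w +
      (t : ℂ) • R ((algebraMap ℝ (H →L[ℂ] H) t⁻¹ - T) w)) = w
    have h : (algebraMap ℝ (H →L[ℂ] H) t⁻¹ - T) w = (t : ℂ)⁻¹ • (w - (t : ℂ) • T w) := by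
      rw [hF, smul_sub, inv_smul_smul₀ htc]
    rw [h, map_smul, hR1, smul_inv_smul₀ htc, smul_add, smul_inv_smul₀ htc, sub_add_cancel]

theorem compressedSupport_inverseSpectralMeasure_subset {K : Type*} [NormedAddCommGroup K]
    [InnerProductSpace ℂ K] [CompleteSpace K] (hT : IsBoundedInverseAt A 0 T)
    (hsa : IsSelfAdjoint T) (V : K →L[ℂ] H) :
    (inverseSpectralMeasure hsa).compressedSupport V ⊆ {t | t ≠ 0} ∩ realSpectrum A := by
  -- An open set whose preimage under inversion meets the spectrum of `T` at most in `0` has zero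
  -- projection.
  have key : ∀ U : Set ℝ, IsOpen U →
      (∀ s : _root_.spectrum ℝ T, (s : ℝ)⁻¹ ∈ U → (s : ℝ) = 0) →
      ∀ t ∈ U, t ∉ (inverseSpectralMeasure hsa).compressedSupport V := by
    intro U hU h t ht hmem
    refine hmem U hU ht ?_
    have hP := isSpectralProjection_calculusProjectionMeasure (cfcHom (R := ℝ) hsa)
      (measurable_inv_spectrum (T := T)) hU.measurableSet
    have h0 : (inverseSpectralMeasure hsa).proj U = 0 := by
      ext x
      have h1 := hP.norm_sq x
      have h2 : (calculusMeasure (cfcHom (R := ℝ) hsa) x).real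
          ((fun s : _root_.spectrum ℝ T => (s : ℝ)⁻¹) ⁻¹' U) = 0 := by
        rw [measureReal_eq_zero_iff]
        exact measure_mono_null (fun s hs => h s hs) (calculusMeasure_singleton_zero hT hsa x)
      rw [h2] at h1
      exact norm_eq_zero.mp (pow_eq_zero_iff two_ne_zero |>.mp h1)
    rw [h0]
    simp
  have hne : ∀ t ∈ (inverseSpectralMeasure hsa).compressedSupport V, t ≠ 0 := by
    rintro t ht rfl
    obtain ⟨M, hM⟩ := (_root_.spectrum.isCompact (𝕜 := ℝ) T).isBounded.exists_norm_le
    -- Since `|s| ≤ M` on the spectrum of the bounded operator `T`, a nonzero `s` has `|s⁻¹| M ≥ 1`.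
    -- Only `s = 0`, through `0⁻¹ = 0`, is sent into this set.
    refine key {u | |u| * M < 1} (isOpen_lt (by fun_prop) (by fun_prop)) (fun s hs => ?_) 0
      (by simp) ht
    by_contra hs0
    have h1 : |(s : ℝ)| ≤ M := hM s s.2
    have h2 : |(s : ℝ)⁻¹| * |(s : ℝ)| = 1 := by
      rw [← abs_mul, inv_mul_cancel₀ hs0, abs_one]
    have h3 : |(s : ℝ)⁻¹| * M < 1 := hs
    have h4 := mul_le_mul_of_nonneg_left h1 (abs_nonneg (s : ℝ)⁻¹)
    linarith
  refine fun t ht => ⟨hne t ht, fun htA => ?_⟩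
  refine key ({u | u ≠ 0} ∩ (fun u => u⁻¹) ⁻¹' (_root_.spectrum ℝ T)ᶜ)
    (continuousOn_inv₀.isOpen_inter_preimage isOpen_ne
      (_root_.spectrum.isClosed (𝕜 := ℝ) T).isOpen_compl) (fun s hs => ?_) t
    ⟨hne t ht, inv_notMem_spectrum hT (hne t ht) htA⟩ ht
  have := hs.2
  simp only [Set.mem_preimage, inv_inv, Set.mem_compl_iff] at this
  exact absurd s.2 this

theorem normSq_one_sub_mul_pos {z : ℂ} (hz : z.im ≠ 0) (s : ℝ) :
    0 < (1 - z.re * s) ^ 2 + (z.im * s) ^ 2 := by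
  by_cases hs : s = 0
  · simp [hs]
  · have : 0 < (z.im * s) ^ 2 := by positivity
    positivity

/-- With `R y = T w` and `y = (1 - z T) w`, the integral is `⟪y, g(T) y⟫` for `g(s) = s² / |1 - z
s|²`. As `|1 - z s|² g(s) = s²`, this equals `⟪w, T² w⟫ = ‖T w‖²`. -/
theorem norm_sq_resolvent_eq_integral (hT : IsBoundedInverseAt A 0 T) (hsa : IsSelfAdjoint T)
    {z : ℂ} (hz : z.im ≠ 0) {R : H →L[ℂ] H} (hR : IsBoundedInverseAt A z R) (y : H) :
    ‖R y‖ ^ 2 = ∫ s, (s : ℝ) ^ 2 / ((1 - z.re * s) ^ 2 + (z.im * s) ^ 2)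
      ∂(calculusMeasure (cfcHom (R := ℝ) hsa) y) := by
  obtain ⟨u, hu, huy⟩ := hR.2 y
  have hTw := hT.apply_map u
  set w := A u
  let g : C(_root_.spectrum ℝ T, ℝ) :=
    ⟨fun s => (s : ℝ) ^ 2 / ((1 - z.re * s) ^ 2 + (z.im * s) ^ 2),
      Continuous.div (by fun_prop) (by fun_prop) fun s => (normSq_one_sub_mul_pos hz s).ne'⟩
  let j := spectrumId T
  have hk : (1 - (2 * z.re) • j + (z.re ^ 2 + z.im ^ 2) • (j * j)) * g = j * j := by
    ext s
    change (1 - (2 * z.re) * (s : ℝ) + (z.re ^ 2 + z.im ^ 2) * ((s : ℝ) * s)) *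
      ((s : ℝ) ^ 2 / ((1 - z.re * s) ^ 2 + (z.im * s) ^ 2)) = s * s
    have := normSq_one_sub_mul_pos hz s
    rw [← mul_div_assoc, div_eq_iff this.ne']
    ring
  set v := cfcHom (R := ℝ) hsa g w with hv
  have hcomm : cfcHom (R := ℝ) hsa g (T w) = T v := by
    have h := calculus_mul_apply (cfcHom (R := ℝ) hsa) g j w
    rw [mul_comm, calculus_mul_apply, cfcHom_spectrumId] at h
    exact h.symm
  have h1 : ⟪w, T (T w)⟫_ℂ =
      ⟪w, v⟫_ℂ - (2 * z.re : ℝ) * ⟪w, T v⟫_ℂ + (z.re ^ 2 + z.im ^ 2 : ℝ) * ⟪w, T (T v)⟫_ℂ := by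
    have h := congrArg (fun f => ⟪w, cfcHom (R := ℝ) hsa f w⟫_ℂ) hk
    simp only [calculus_mul_apply, map_add, map_sub, map_smul, add_apply, sub_apply, smul_apply,
      calculus_one_apply, inner_add_right, inner_sub_right] at h
    rw [← hv, cfcHom_spectrumId, ← Complex.coe_smul, ← Complex.coe_smul, inner_smul_right,
      inner_smul_right] at h
    exact h.symm
  have hyw : y = w - z • T w := by rw [hTw]; exact huy.symm
  have h2 : ⟪y, cfcHom (R := ℝ) hsa g y⟫_ℂ = ⟪w, T (T w)⟫_ℂ := by
    have hc : (starRingEnd ℂ) z * z = ((z.re ^ 2 + z.im ^ 2 : ℝ) : ℂ) := by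
      rw [← Complex.normSq_eq_conj_mul_self, Complex.normSq_apply]
      congr 1
      ring
    have hc' : z + (starRingEnd ℂ) z = ((2 * z.re : ℝ) : ℂ) := Complex.add_conj z
    rw [h1, hyw, map_sub, map_smul, hcomm, ← hv, inner_sub_left, inner_sub_right, inner_sub_right,
      inner_smul_left, inner_smul_left, inner_smul_right, inner_smul_right,
      inner_apply_eq_of_isSelfAdjoint hsa, inner_apply_eq_of_isSelfAdjoint hsa, ← hc, ← hc']
    ring
  have h3 := integral_calculusMeasure (cfcHom (R := ℝ) hsa) g y
  rw [h2, ← inner_apply_eq_of_isSelfAdjoint hsa, hTw, hu, inner_self_eq_norm_sq_to_K] at h3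
  refine Eq.trans ?_ h3.symm
  norm_cast

end InverseOperator

/-! ### Openness of the resolvent set -/

section ResolventSet

variable {H : Type*} [NormedAddCommGroup H] [NormedSpace ℂ H] [CompleteSpace H]

/-- On the domain, `T - z' = (1 - (z' - z) R) (T - z)`, and the first factor is invertible by the
Neumann series for `z'` near `z`. -/
theorem isOpen_resolventSet (T : H →ₗ.[ℂ] H) : IsOpen (resolventSet T) := by
  rw [isOpen_iff_mem_nhds]
  rintro z ⟨R, hR⟩
  have hev : ∀ᶠ z' in nhds z, ‖(z' - z) • R‖ < 1 := by
    have hcont : Continuous fun z' => ‖(z' - z) • R‖ := by fun_prop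
    exact hcont.continuousAt.eventually_lt continuousAt_const (by simp)
  filter_upwards [hev] with z' hz'
  obtain ⟨K, hK⟩ := isUnit_one_sub_of_norm_lt_one hz'
  have hKy : ∀ y, (K : H →L[ℂ] H) y = y - (z' - z) • R y := fun y => by rw [hK]; rfl
  have hinv1 : ∀ y, (↑K⁻¹ : H →L[ℂ] H) ((K : H →L[ℂ] H) y) = y := fun y =>
    congrArg (fun P : H →L[ℂ] H => P y) K.inv_mul
  have hinv2 : ∀ y, (K : H →L[ℂ] H) ((↑K⁻¹ : H →L[ℂ] H) y) = y := fun y =>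
    congrArg (fun P : H →L[ℂ] H => P y) K.mul_inv
  refine ⟨R ∘L (↑K⁻¹ : H →L[ℂ] H), fun x => ?_, fun y => ?_⟩
  · have h : T x - z' • (x : H) = (K : H →L[ℂ] H) (T x - z • (x : H)) := by
      rw [hKy, hR.1, sub_smul]; abel
    rw [ContinuousLinearMap.comp_apply, h, hinv1, hR.1]
  · obtain ⟨x, hx, hxy⟩ := hR.2 ((↑K⁻¹ : H →L[ℂ] H) y)
    refine ⟨x, hx, ?_⟩
    have h := hinv2 y
    rw [hKy, ← hx, ← hxy, sub_smul] at h
    rw [← h]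
    abel

theorem isClosed_realSpectrum (T : H →ₗ.[ℂ] H) : _root_.IsClosed (realSpectrum T) :=
  (isOpen_resolventSet T).isClosed_compl.preimage Complex.continuous_ofReal

end ResolventSet

/-! ### Scalar estimates and sector geometry -/

section Estimates

theorem norm_sub_ofReal_sq (z : ℂ) (t : ℝ) : ‖z - t‖ ^ 2 = (z.re - t) ^ 2 + z.im ^ 2 := by
  rw [← Complex.normSq_eq_norm_sq, Complex.normSq_apply]
  simp
  ring

/-- The ratio `c² t² / |z - t|²` is below `1` on `s` but tends to `c²` at infinity, so for `c = 1`
and unbounded `s` it need not stay below a constant `q < 1`. Compactness yields `q` for `|t| ≤ r`;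
for larger `|t|` the excess `(1 - q) / (c² t²)` is at most the constant `β = (1 - q) / (c r)²`. In
the application `b = ‖B‖`, so `α c² + β b²` bounds `‖R B‖²`. -/
theorem exists_uniform_resolvent_bound {s : Set ℝ} (hs : IsClosed s) {z : ℂ} (hz : z.im ≠ 0)
    {b c : ℝ} (hc : 0 < c) (hb : 0 ≤ b) (h : ∀ t ∈ s, |t| * c < ‖z - t‖) :
    ∃ α β, 0 ≤ α ∧ 0 ≤ β ∧ α * c ^ 2 + β * b ^ 2 < 1 ∧
      ∀ t ∈ s, t ≠ 0 → (‖z - t‖ ^ 2)⁻¹ ≤ α * (t ^ 2)⁻¹ + β := by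
  have hN : ∀ t : ℝ, 0 < ‖z - t‖ ^ 2 := by
    intro t
    rw [norm_sub_ofReal_sq]
    have : 0 < z.im ^ 2 := by positivity
    positivity
  have hlt : ∀ t ∈ s, c ^ 2 * t ^ 2 / ‖z - t‖ ^ 2 < 1 := by
    intro t ht
    rw [div_lt_one (hN t), ← sq_abs t, ← mul_pow, mul_comm]
    have := h t ht
    gcongr
  -- Chosen so that `2 b ≤ c r`: then `β b² ≤ (1 - q) / 4`, and the total is at most `q + (1 - q) /
  -- 4 < 1`. The `+ 1` keeps `r` positive when `b = 0`.
  set r := 2 * b / c + 1 with hr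
  have hr0 : 0 < r := by positivity
  have hbr : b ^ 2 ≤ (c * r) ^ 2 / 4 := by
    have h1 : 2 * b ≤ c * r := by rw [hr]; field_simp; linarith
    nlinarith
  obtain ⟨q, hq0, hq1, hq⟩ : ∃ q : ℝ, 0 ≤ q ∧ q < 1 ∧
      ∀ t ∈ s, |t| ≤ r → c ^ 2 * t ^ 2 / ‖z - t‖ ^ 2 ≤ q := by
    rcases (s ∩ Metric.closedBall 0 r).eq_empty_or_nonempty with he | hne
    · refine ⟨0, le_rfl, one_pos, fun t ht htr => ?_⟩
      have : t ∈ s ∩ Metric.closedBall 0 r := ⟨ht, by simpa using htr⟩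
      rw [he] at this
      exact this.elim
    · have hcomp : IsCompact (s ∩ Metric.closedBall 0 r) := (isCompact_closedBall 0 r).inter_left hs
      obtain ⟨t₀, ht₀, hmax⟩ := hcomp.exists_isMaxOn
        (f := fun t : ℝ => c ^ 2 * t ^ 2 / ‖z - t‖ ^ 2) hne
        (Continuous.div (by fun_prop) (by fun_prop) fun t => (hN t).ne').continuousOn
      exact ⟨_, by positivity, hlt t₀ ht₀.1, fun t ht htr => hmax ⟨ht, by simpa using htr⟩⟩
  have hq1' : 0 ≤ 1 - q := by linarith
  refine ⟨q / c ^ 2, (1 - q) / (c * r) ^ 2, by positivity, by positivity, ?_, fun t ht ht0 => ?_⟩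
  · have h1 : (1 - q) / (c * r) ^ 2 * b ^ 2 ≤ (1 - q) / 4 := by
      calc (1 - q) / (c * r) ^ 2 * b ^ 2 ≤ (1 - q) / (c * r) ^ 2 * ((c * r) ^ 2 / 4) := by gcongr
        _ = (1 - q) / 4 := by field_simp
    rw [div_mul_cancel₀ _ (by positivity)]
    linarith
  · have ht2 : 0 < t ^ 2 := by positivity
    have hscale : ∀ a, c ^ 2 * t ^ 2 / ‖z - t‖ ^ 2 ≤ a → (‖z - t‖ ^ 2)⁻¹ ≤ a / (c ^ 2 * t ^ 2) := by
      intro a ha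
      rw [le_div_iff₀ (by positivity), mul_comm, ← div_eq_mul_inv]
      exact ha
    have hform : q / c ^ 2 * (t ^ 2)⁻¹ = q / (c ^ 2 * t ^ 2) := by field_simp
    rw [hform]
    rcases le_or_gt |t| r with htr | htr
    · exact (hscale q (hq t ht htr)).trans (le_add_of_nonneg_right (by positivity))
    · have h1 := hscale 1 (hlt t ht).le
      have h2 : (1 - q) / (c ^ 2 * t ^ 2) ≤ (1 - q) / (c * r) ^ 2 := by
        rw [mul_pow, ← sq_abs t]
        gcongr
      calc (‖z - t‖ ^ 2)⁻¹ ≤ 1 / (c ^ 2 * t ^ 2) := h1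
        _ = q / (c ^ 2 * t ^ 2) + (1 - q) / (c ^ 2 * t ^ 2) := by ring
        _ ≤ _ := by gcongr

theorem abs_im_le_of_mem_closedBall {c : ℝ} (hc0 : 0 ≤ c) (hc : c < 1) {a : ℝ} {z : ℂ}
    (hz : z ∈ Metric.closedBall (a : ℂ) (|a| * c)) :
    |z.im| ≤ c / √(1 - c ^ 2) * |z.re| := by
  have hpos : 0 < 1 - c ^ 2 := by nlinarith
  have h1 : (z.re - a) ^ 2 + z.im ^ 2 ≤ a ^ 2 * c ^ 2 := by
    rw [Metric.mem_closedBall, dist_eq_norm] at hz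
    rw [← norm_sub_ofReal_sq, ← sq_abs a, ← mul_pow]
    gcongr
  refine abs_le_of_sq_le_sq' ?_ (by positivity) |> abs_le.mpr
  rw [mul_pow, div_pow, Real.sq_sqrt hpos.le, sq_abs, div_mul_eq_mul_div, le_div_iff₀ hpos]
  -- The identity `c² x² - (1 - c²) (a² c² - (x - a)²) = (x - (1 - c²) a)²`, with `x = Re z`; its
  -- zero is the abscissa of tangency.
  nlinarith [sq_nonneg (z.re - (1 - c ^ 2) * a)]

theorem abs_im_le_iff_norm {c : ℝ} (hc0 : 0 ≤ c) (hc : c < 1) (z : ℂ) :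
    |z.im| ≤ c / √(1 - c ^ 2) * |z.re| ↔ |z.im| ≤ c * ‖z‖ := by
  have hpos : 0 < 1 - c ^ 2 := by nlinarith
  have hn : ‖z‖ ^ 2 = z.re ^ 2 + z.im ^ 2 := by
    rw [← Complex.normSq_eq_norm_sq, Complex.normSq_apply]; ring
  rw [← pow_le_pow_iff_left₀ (abs_nonneg _) (by positivity) two_ne_zero,
    ← pow_le_pow_iff_left₀ (abs_nonneg z.im) (by positivity : 0 ≤ c * ‖z‖) two_ne_zero,
    mul_pow, mul_pow, div_pow, Real.sq_sqrt hpos.le, sq_abs, sq_abs, div_mul_eq_mul_div,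
    le_div_iff₀ hpos, hn]
  constructor <;> intro h <;> nlinarith

/-- In the right half-plane `arg z = arcsin (Im z / |z|)`, and `arcsin` is strictly increasing on
`[-1, 1]`. -/
theorem abs_arg_le_arcsin_iff {c : ℝ} (hc0 : 0 ≤ c) (hc : c < 1) {z : ℂ} (hz : 0 < z.re) :
    |z.arg| ≤ Real.arcsin c ↔ |z.im| ≤ c * ‖z‖ := by
  have hn : 0 < ‖z‖ := norm_pos_iff.mpr fun h => by simp [h] at hz
  have hle : |z.im / ‖z‖| ≤ 1 := by
    rw [abs_div, abs_norm, div_le_one hn]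
    exact Complex.abs_im_le_norm z
  obtain ⟨hl, hu⟩ := abs_le.mp hle
  rw [Complex.arg_of_re_nonneg hz.le, abs_le, ← Real.arcsin_neg,
    Real.strictMonoOn_arcsin.le_iff_le ⟨by linarith, by linarith⟩ ⟨hl, hu⟩,
    Real.strictMonoOn_arcsin.le_iff_le ⟨hl, hu⟩ ⟨by linarith, by linarith⟩, ← abs_le, abs_div,
    abs_norm, div_le_iff₀ hn]

theorem sector_eq_doubleSector {c : ℝ} (hc0 : 0 ≤ c) (hc : c < 1) :
    {z : ℂ | |z.im| ≤ c / √(1 - c ^ 2) * |z.re|} = doubleSector (Real.arcsin c) := by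
  have hlt : Real.arcsin c < Real.pi / 2 := Real.arcsin_lt_pi_div_two.mpr hc
  have h0 : 0 ≤ Real.arcsin c := Real.arcsin_nonneg.mpr hc0
  ext z
  change _ ↔ |z.arg| ≤ Real.arcsin c ∨ |(-z).arg| ≤ Real.arcsin c
  rw [Set.mem_ofPred_eq]
  rcases lt_trichotomy z.re 0 with hz | hz | hz
  · have hz' : 0 < (-z).re := by simpa using hz
    have h1 : ¬ |z.arg| ≤ Real.arcsin c := fun h => by
      rcases Complex.abs_arg_lt_pi_div_two_iff.mp (h.trans_lt hlt) with h | h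
      · linarith
      · simp [h] at hz
    rw [abs_im_le_iff_norm hc0 hc, abs_arg_le_arcsin_iff hc0 hc hz', norm_neg, Complex.neg_im,
      abs_neg]
    tauto
  · rw [hz, abs_zero, mul_zero]
    constructor
    · intro h
      have : z = 0 := Complex.ext hz (by simpa using h)
      left
      simpa [this] using h0
    · intro h
      have hz0 : z = 0 := by
        rcases h with h | h
        · rcases Complex.abs_arg_lt_pi_div_two_iff.mp (h.trans_lt hlt) with h | h
          · linarith
          · exact h
        · rcases Complex.abs_arg_lt_pi_div_two_iff.mp (h.trans_lt hlt) with h | h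
          · rw [Complex.neg_re] at h
            linarith
          · exact neg_eq_zero.mp h
      simp [hz0]
  · have hz' : ¬ 0 < (-z).re := by simpa using hz.le
    have h1 : ¬ |(-z).arg| ≤ Real.arcsin c := fun h => by
      rcases Complex.abs_arg_lt_pi_div_two_iff.mp (h.trans_lt hlt) with h | h
      · exact hz' h
      · simp [neg_eq_zero.mp h] at hz
    rw [abs_im_le_iff_norm hc0 hc, abs_arg_le_arcsin_iff hc0 hc hz]
    tauto

end Estimates

/-! ### Bound on the resolvent composed with `B`, and localization of the nonreal spectrum -/

section Enclosure

variable {Hp Hm : Type*}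
    [NormedAddCommGroup Hp] [InnerProductSpace ℂ Hp] [CompleteSpace Hp]
    [NormedAddCommGroup Hm] [InnerProductSpace ℂ Hm] [CompleteSpace Hm]

theorem norm_sq_resolvent_le {A : Hp →ₗ.[ℂ] Hp} {T : Hp →L[ℂ] Hp}
    (hT : IsBoundedInverseAt A 0 T) (hsa : IsSelfAdjoint T) {z : ℂ}
    (hz : z.im ≠ 0) {R : Hp →L[ℂ] Hp} (hR : IsBoundedInverseAt A z R) {α β : ℝ} {y : Hp}
    (h : ∀ᵐ s : _root_.spectrum ℝ T ∂(calculusMeasure (cfcHom (R := ℝ) hsa) y),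
      (s : ℝ) ^ 2 / ((1 - z.re * s) ^ 2 + (z.im * s) ^ 2) ≤ α * (s : ℝ) ^ 2 + β) :
    ‖R y‖ ^ 2 ≤ α * ‖T y‖ ^ 2 + β * ‖y‖ ^ 2 := by
  have hint : Integrable (fun s : _root_.spectrum ℝ T => α * (s : ℝ) ^ 2)
      (calculusMeasure (cfcHom (R := ℝ) hsa) y) :=
    ((integrable_calculusMeasure (cfcHom (R := ℝ) hsa) (spectrumId T * spectrumId T) y).congr
      (Filter.Eventually.of_forall fun s => (sq (s : ℝ)).symm)).const_mul α
  have hT2 : ∫ s : _root_.spectrum ℝ T, (s : ℝ) ^ 2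
      ∂(calculusMeasure (cfcHom (R := ℝ) hsa) y) = ‖T y‖ ^ 2 := by
    have h1 := norm_sq_calculus_eq_integral (cfcHom (R := ℝ) hsa) (spectrumId T) y
    rw [cfcHom_spectrumId] at h1
    exact h1.symm
  have hone : ∫ _ : _root_.spectrum ℝ T, β ∂(calculusMeasure (cfcHom (R := ℝ) hsa) y) =
      β * ‖y‖ ^ 2 := by
    have h1 := norm_sq_calculus_eq_integral (cfcHom (R := ℝ) hsa) 1 y
    rw [calculus_one_apply] at h1
    rw [h1, ← integral_const_mul]
    simp
  rw [norm_sq_resolvent_eq_integral hT hsa hz hR y, ← hT2, ← hone, ← integral_const_mul,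
    ← integral_add hint (integrable_const β)]
  exact integral_mono_of_nonneg (Filter.Eventually.of_forall fun s => by positivity)
    (hint.add (integrable_const β)) h

theorem exists_resolvent_comp_bound {A : Hp →ₗ.[ℂ] Hp} {T : Hp →L[ℂ] Hp}
    (hT : IsBoundedInverseAt A 0 T) (hsa : IsSelfAdjoint T) (B : Hm →L[ℂ] Hp) {z : ℂ}
    (hz : z.im ≠ 0) {R : Hp →L[ℂ] Hp} (hR : IsBoundedInverseAt A z R)
    (h : ∀ t ∈ (inverseSpectralMeasure hsa).compressedSupport B, |t| * ‖T ∘L B‖ < ‖z - t‖) :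
    ∃ q < 1, ∀ x, ‖R (B x)‖ ^ 2 ≤ q * ‖x‖ ^ 2 := by
  -- The scalar estimate divides by `‖T B‖`. If this norm vanishes, injectivity of `T` gives `B =
  -- 0`.
  rcases (norm_nonneg (T ∘L B)).eq_or_lt with hc | hc
  · refine ⟨0, one_pos, fun x => ?_⟩
    have h1 : B x = 0 := hT.eq_zero
      (congrArg (fun P : Hm →L[ℂ] Hp => P x) (norm_eq_zero.mp hc.symm))
    simp [h1]
  obtain ⟨α, β, hα, hβ, hlt, hb⟩ := exists_uniform_resolvent_bound
    ((inverseSpectralMeasure hsa).isClosed_compressedSupport B) hz hc (norm_nonneg B) h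
  refine ⟨_, hlt, fun x => ?_⟩
  have hae : ∀ᵐ s : _root_.spectrum ℝ T ∂(calculusMeasure (cfcHom (R := ℝ) hsa) (B x)),
      (s : ℝ)⁻¹ ∈ (inverseSpectralMeasure hsa).compressedSupport B := by
    have h1 := (inverseSpectralMeasure hsa).ae_mem_compressedSupport B x
    rw [inverseSpectralMeasure, scalarMeasure_calculusProjectionMeasure] at h1
    exact ae_of_ae_map measurable_inv_spectrum.aemeasurable h1
  have hTB : ‖T (B x)‖ ≤ ‖T ∘L B‖ * ‖x‖ := (T ∘L B).le_opNorm x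
  have hBx : ‖B x‖ ≤ ‖B‖ * ‖x‖ := B.le_opNorm x
  have hbound : ‖R (B x)‖ ^ 2 ≤ α * ‖T (B x)‖ ^ 2 + β * ‖B x‖ ^ 2 := by
    refine norm_sq_resolvent_le hT hsa hz hR ?_
    filter_upwards [hae] with s hs
    have hinv0 := (compressedSupport_inverseSpectralMeasure_subset hT hsa B hs).1
    have hs0 : (s : ℝ) ≠ 0 := fun h0 => hinv0 (by simp [h0])
    have h1 := hb _ hs hinv0
    rw [norm_sub_ofReal_sq, inv_pow, inv_inv] at h1
    refine le_trans (le_of_eq ?_) h1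
    -- Substituting `t = s⁻¹` gives `s² / |1 - z s|² = |z - t|⁻²`.
    have h2 : (1 - z.re * s) ^ 2 + (z.im * s) ^ 2 =
        (s : ℝ) ^ 2 * ((z.re - (s : ℝ)⁻¹) ^ 2 + z.im ^ 2) := by
      field_simp
      ring
    rw [h2, div_mul_eq_div_div, div_self (pow_ne_zero 2 hs0), one_div]
  calc ‖R (B x)‖ ^ 2 ≤ α * ‖T (B x)‖ ^ 2 + β * ‖B x‖ ^ 2 := hbound
    _ ≤ α * (‖T ∘L B‖ * ‖x‖) ^ 2 + β * (‖B‖ * ‖x‖) ^ 2 := by gcongr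
    _ = _ := by ring

theorem exists_mem_closedBall_of_mem_spectrum {A : Hp →ₗ.[ℂ] Hp} (hA : IsSelfAdjoint A)
    {D : Hm →ₗ.[ℂ] Hm} (hD : IsSelfAdjoint D) {T : Hp →L[ℂ] Hp}
    (hT : IsBoundedInverseAt A 0 T) (hsa : IsSelfAdjoint T) (B : Hm →L[ℂ] Hp) {z : ℂ}
    (hz : z.im ≠ 0)
    (hzS : z ∈ spectrum (blockOperator A B (-(ContinuousLinearMap.adjoint B)) D)) :
    ∃ a ∈ (inverseSpectralMeasure hsa).compressedSupport B,
      z ∈ Metric.closedBall (a : ℂ) (|a| * ‖T ∘L B‖) := by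
  by_contra! hcon
  obtain ⟨R, hR⟩ := mem_resolventSet_of_im_ne_zero hA hz
  obtain ⟨q, hq, hRB⟩ := exists_resolvent_comp_bound hT hsa B hz hR fun t ht => by
    have := hcon t ht
    rwa [Metric.mem_closedBall, not_le, dist_eq_norm] at this
  exact hzS (mem_resolventSet_blockOperator hA hD B hz hR hq hRB)

theorem re_mem_Icc_of_mem_closedBall {a r : ℝ} {z : ℂ}
    (hz : z ∈ Metric.closedBall (a : ℂ) r) : z.re ∈ Set.Icc (a - r) (a + r) := by
  rw [Metric.mem_closedBall, dist_eq_norm] at hz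
  have h := abs_le.mp ((Complex.abs_re_le_norm (z - a)).trans hz)
  rw [Complex.sub_re, Complex.ofReal_re] at h
  exact ⟨by linarith [h.1], by linarith [h.2]⟩

end Enclosure

end SpecEncl

end

/-! ### The spectral enclosure and its consequences -/

theorem corollary4p9 {Hp Hm : Type*}
    [NormedAddCommGroup Hp] [InnerProductSpace ℂ Hp] [CompleteSpace Hp]
    [NormedAddCommGroup Hm] [InnerProductSpace ℂ Hm] [CompleteSpace Hm]
    (A : Hp →ₗ.[ℂ] Hp) (hA : IsSelfAdjoint A)
    (D : Hm →ₗ.[ℂ] Hm) (hD : IsSelfAdjoint D)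
    (B : Hm →L[ℂ] Hp)
    (S : WithLp 2 (Hp × Hm) →ₗ.[ℂ] WithLp 2 (Hp × Hm))
    (hS : S = SpecEncl.blockOperator A B (-(ContinuousLinearMap.adjoint B)) D)
    (h0 : (0 : ℂ) ∈ SpecEncl.resolventSet A)
    (c : ℝ) (hc : c = ‖(SpecEncl.resolventOp A 0) ∘L B‖) :
    (SpecEncl.spectrum S ∩ SpecEncl.nonreal ⊆
      ⋃ a ∈ SpecEncl.spectrumAlong B A, Metric.closedBall (a : ℂ) (|a| * c)) ∧
    (c < 1 →
      ((⋃ a ∈ SpecEncl.spectrumAlong B A, Metric.closedBall (a : ℂ) (|a| * c)) ⊆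
        {z : ℂ | |z.im| ≤ c / √(1 - c ^ 2) * |z.re|}) ∧
      {z : ℂ | |z.im| ≤ c / √(1 - c ^ 2) * |z.re|} =
        SpecEncl.doubleSector (Real.arcsin c) ∧
      ((SpecEncl.realSpectrum A ∩ Set.Ioi 0).Nonempty →
        ∃ m : ℝ, IsLeast (SpecEncl.realSpectrum A ∩ Set.Ioi 0) m ∧
          SpecEncl.spectrum S ∩ SpecEncl.nonreal ∩ {z : ℂ | 0 < z.re} ⊆
            {z : ℂ | (1 - c) * m ≤ z.re}) ∧
      (SpecEncl.realSpectrum A ∩ Set.Ioi 0 = ∅ →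
        SpecEncl.spectrum S ∩ SpecEncl.nonreal ∩ {z : ℂ | 0 < z.re} = ∅) ∧
      ((SpecEncl.realSpectrum A ∩ Set.Iio 0).Nonempty →
        ∃ m : ℝ, IsGreatest (SpecEncl.realSpectrum A ∩ Set.Iio 0) m ∧
          SpecEncl.spectrum S ∩ SpecEncl.nonreal ∩ {z : ℂ | z.re < 0} ⊆
            {z : ℂ | z.re ≤ (1 - c) * m}) ∧
      (SpecEncl.realSpectrum A ∩ Set.Iio 0 = ∅ →
        SpecEncl.spectrum S ∩ SpecEncl.nonreal ∩ {z : ℂ | z.re < 0} = ∅)) := by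
  subst hS
  have hT := SpecEncl.isBoundedInverseAt_resolventOp h0
  have hsa := hT.isSelfAdjoint hA
  have hc0 : 0 ≤ c := hc ▸ norm_nonneg _
  have hE := SpecEncl.isSpectralMeasureOf_inverseSpectralMeasure hT hsa
  have hloc : ∀ z ∈ SpecEncl.spectrum
      (SpecEncl.blockOperator A B (-(ContinuousLinearMap.adjoint B)) D) ∩ SpecEncl.nonreal,
      ∃ a ∈ SpecEncl.realSpectrum A ∩ SpecEncl.spectrumAlong B A,
        z ∈ Metric.closedBall (a : ℂ) (|a| * c) := by
    rintro z ⟨hzS, hz⟩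
    obtain ⟨a, ha, hza⟩ := SpecEncl.exists_mem_closedBall_of_mem_spectrum hA hD hT hsa B hz hzS
    rw [← hc] at hza
    exact ⟨a, ⟨(SpecEncl.compressedSupport_inverseSpectralMeasure_subset hT hsa B ha).2,
      _, hE, ha⟩, hza⟩
  have h0A : (0 : ℝ) ∉ SpecEncl.realSpectrum A := fun h => h (by simpa using h0)
  have hclosed := SpecEncl.isClosed_realSpectrum A
  refine ⟨fun z hz => ?_, fun hc1 => ?_⟩
  · obtain ⟨a, ha, hza⟩ := hloc z hz
    exact Set.mem_iUnion₂.mpr ⟨a, ha.2, hza⟩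
  have hpos : ∀ z ∈ SpecEncl.spectrum
      (SpecEncl.blockOperator A B (-(ContinuousLinearMap.adjoint B)) D) ∩ SpecEncl.nonreal,
      0 < z.re → ∃ a ∈ SpecEncl.realSpectrum A ∩ Set.Ioi 0, (1 - c) * a ≤ z.re := by
    intro z hz hre
    obtain ⟨a, ha, hza⟩ := hloc z hz
    have h := SpecEncl.re_mem_Icc_of_mem_closedBall hza
    have ha0 : 0 < a := by
      -- For `a ≤ 0` the disc lies in `Re z ≤ (1 - c) a ≤ 0`, so only positive centres can reach the
      -- right half-plane.
      by_contra! hcon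
      rw [abs_of_nonpos hcon] at h
      nlinarith [h.2]
    rw [abs_of_pos ha0] at h
    exact ⟨a, ⟨ha.1, ha0⟩, by linarith [h.1]⟩
  have hneg : ∀ z ∈ SpecEncl.spectrum
      (SpecEncl.blockOperator A B (-(ContinuousLinearMap.adjoint B)) D) ∩ SpecEncl.nonreal,
      z.re < 0 → ∃ a ∈ SpecEncl.realSpectrum A ∩ Set.Iio 0, z.re ≤ (1 - c) * a := by
    intro z hz hre
    obtain ⟨a, ha, hza⟩ := hloc z hz
    have h := SpecEncl.re_mem_Icc_of_mem_closedBall hza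
    have ha0 : a < 0 := by
      by_contra! hcon
      rw [abs_of_nonneg hcon] at h
      nlinarith [h.1]
    rw [abs_of_neg ha0] at h
    exact ⟨a, ⟨ha.1, ha0⟩, by linarith [h.2]⟩
  -- As `0 ∉ σ(A)`, the open half-line may be replaced by the closed one, which makes the set closed
  -- and its infimum attained.
  have hIoi : SpecEncl.realSpectrum A ∩ Set.Ioi 0 = SpecEncl.realSpectrum A ∩ Set.Ici 0 := by
    ext t
    exact ⟨fun h => ⟨h.1, Set.mem_Ici.mpr (Set.mem_Ioi.mp h.2).le⟩, fun h =>
      ⟨h.1, lt_of_le_of_ne h.2 (ne_of_mem_of_not_mem h.1 h0A).symm⟩⟩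
  have hIio : SpecEncl.realSpectrum A ∩ Set.Iio 0 = SpecEncl.realSpectrum A ∩ Set.Iic 0 := by
    ext t
    exact ⟨fun h => ⟨h.1, Set.mem_Iic.mpr (Set.mem_Iio.mp h.2).le⟩, fun h =>
      ⟨h.1, lt_of_le_of_ne h.2 (ne_of_mem_of_not_mem h.1 h0A)⟩⟩
  refine ⟨fun z hz => ?_, SpecEncl.sector_eq_doubleSector hc0 hc1, fun hne => ?_, fun he => ?_,
    fun hne => ?_, fun he => ?_⟩
  · obtain ⟨a, -, hza⟩ := Set.mem_iUnion₂.mp hz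
    exact SpecEncl.abs_im_le_of_mem_closedBall hc0 hc1 hza
  · have hleast : IsLeast (SpecEncl.realSpectrum A ∩ Set.Ioi 0)
        (sInf (SpecEncl.realSpectrum A ∩ Set.Ioi 0)) :=
      IsClosed.isLeast_csInf (hIoi ▸ hclosed.inter isClosed_Ici) hne ⟨0, fun t ht => ht.2.le⟩
    refine ⟨_, hleast, fun z ⟨hz, hre⟩ => ?_⟩
    obtain ⟨a, ha, hle⟩ := hpos z hz hre
    exact (mul_le_mul_of_nonneg_left (hleast.2 ha) (by linarith)).trans hle
  · refine Set.eq_empty_of_forall_notMem fun z ⟨hz, hre⟩ => ?_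
    obtain ⟨a, ha, -⟩ := hpos z hz hre
    exact (he ▸ ha : a ∈ (∅ : Set ℝ))
  · have hgreatest : IsGreatest (SpecEncl.realSpectrum A ∩ Set.Iio 0)
        (sSup (SpecEncl.realSpectrum A ∩ Set.Iio 0)) :=
      IsClosed.isGreatest_csSup (hIio ▸ hclosed.inter isClosed_Iic) hne ⟨0, fun t ht => ht.2.le⟩
    refine ⟨_, hgreatest, fun z ⟨hz, hre⟩ => ?_⟩
    obtain ⟨a, ha, hle⟩ := hneg z hz hre
    exact hle.trans (mul_le_mul_of_nonneg_left (hgreatest.2 ha) (by linarith))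
  · refine Set.eq_empty_of_forall_notMem fun z ⟨hz, hre⟩ => ?_
    obtain ⟨a, ha, -⟩ := hneg z hz hre
    exact (he ▸ ha : a ∈ (∅ : Set ℝ))
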